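/- Let $G$ be a Fréchet Lie group, i.e. a topological group that is a smooth manifold modelled on a locally convex, complete, Hausdorff real vector space, with smooth multiplication and inversion. Let $\Delta^n=\{x\in\mathbb R^n\mid x_i\ge 0,\ \sum x_i\le 1\}$, viewed as a manifold with corners. A *smooth simplicial set* is a functor $X:(\Delta^{sm})^{op}\to \mathrm{Set}$, where $\Delta^{sm}$ has objects the simplices $\Delta^n$, $n\ge 0$, and morphisms all smooth maps between them; its underlying simplicial set is the restriction to the affine maps that send vertices to vertices in an order preserving way. Write $\Delta^n_\bullet=\hom_{\Delta^{sm}}(-,\Delta^n)$. Let $\Delta^{sm}(X)$ be the category whose objects are the smooth maps (natural transformations) $\Sigma:\Delta^d_\bullet\to X$, $d\ge 0$, and whose morphisms $\Sigma_1\to\Sigma_2$ are the smooth maps $f:\Delta^{d_1}\to\Delta^{d_2}$ with $\Sigma_2\circ f_\bullet=\Sigma_1$. A *simplicial $G$-bundle* $P$ over $X$ is a functor from $\Delta^{sm}(X)$ to the category of smooth principal $G$-bundles and smooth $G$-bundle maps, such that $P(\Sigma)$ is a bundle over $\Delta^d$ for each $\Sigma:\Delta^d_\bullet\to X$, and such that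 $P(f)$ is a bundle map over $f$ for each morphism $f$. Its pull-back along a smooth map $h:Y\to X$ is $h^*P=P\circ\Delta^{sm}(h)$. Let $\mathcal U$ be a $G$-admissible Grothendieck universe, i.e. a Grothendieck universe that contains $G$ and every $\Delta^n$. A simplicial $G$-bundle $P$ is *$\mathcal U$-small* if $P(\Sigma)\in\mathcal U$ for all $\Sigma$. Let $BG^{\mathcal U}$ be the smooth simplicial set whose $k$-simplices are the $\mathcal U$-small simplicial $G$-bundles over $\Delta^k_\bullet$, on which a smooth map $\sigma:\Delta^m\to\Delta^k$ acts by $P\mapsto\sigma_\bullet^*P$. Then (the underlying simplicial set of) $BG^{\mathcal U}$ is a Kan complex: for all $n\ge 1$ and $0\le k\le n$, every simplicial map $\Lambda^n_k\to BG^{\mathcal U}$ extends to a simplicial map $\Delta^n_{simp}\to BG^{\mathcal U}$, where $\Delta^n_{simp}$ is the standard simplicial $n$-simplex and $\Lambda^n_k\subset\Delta^n_{simp}$ is its $k$-th horn. -/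

import Mathlib

open CategoryTheory Opposite Filter Topology
open scoped ContDiff

universe u v w t

/-! ## Calculus in locally convex spaces -/

/-- `f` is of class `C^k` on `U` (meant for open `U`) in the sense of Michal and Bastiani: `f` is
continuous, all directional derivatives `df (x, v)` exist for `x ∈ U`, and `df` is of class
`C^(k-1)` (in particular jointly continuous) on `U × E`. -/
def IsBastianiC {F : Type v} [AddCommGroup F] [Module ℝ F] [TopologicalSpace F] :
    ℕ → ∀ {E : Type u} [AddCommGroup E] [Module ℝ E] [TopologicalSpace E],
      (E → F) → Set E → Prop
  | 0, _, _, _, _, f, U => ContinuousOn f U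
  | k + 1, E, _, _, _, f, U => ContinuousOn f U ∧ ∃ df : E × E → F,
      (∀ x ∈ U, ∀ v : E,
        Tendsto (fun s : ℝ => s⁻¹ • (f (x + s • v) - f x)) (𝓝[≠] 0) (𝓝 (df (x, v)))) ∧
      IsBastianiC k df (U ×ˢ (Set.univ : Set E))

/-- Smooth maps between open subsets of locally convex spaces. -/
def IsBastianiSmooth {E : Type u} {F : Type v} [AddCommGroup E] [Module ℝ E] [TopologicalSpace E]
    [AddCommGroup F] [Module ℝ F] [TopologicalSpace F] (f : E → F) (U : Set E) : Prop :=
  ∀ k : ℕ, IsBastianiC k f U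

/-- A Fréchet Lie group: a topological group `G` with an atlas of charts in a locally convex, complete,
Hausdorff real vector space `E`, with smooth chart changes, smooth multiplication and smooth
inversion. -/
class FrechetLieGroup (E : Type v) [AddCommGroup E] [Module ℝ E] [UniformSpace E]
    [IsUniformAddGroup E] [ContinuousSMul ℝ E] [LocallyConvexSpace ℝ E] [T2Space E]
    [CompleteSpace E]
    (G : Type w) [Group G] [TopologicalSpace G] [IsTopologicalGroup G] [ChartedSpace E G] :
    Prop where
  smooth_chart_change : ∀ e ∈ atlas E G, ∀ e' ∈ atlas E G,
    IsBastianiSmooth (fun x => e' (e.symm x)) {x | x ∈ e.target ∧ e.symm x ∈ e'.source}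
  smooth_mul : ∀ e₁ ∈ atlas E G, ∀ e₂ ∈ atlas E G, ∀ e₃ ∈ atlas E G,
    IsBastianiSmooth (fun x : E × E => e₃ (e₁.symm x.1 * e₂.symm x.2))
      {x | x.1 ∈ e₁.target ∧ x.2 ∈ e₂.target ∧ e₁.symm x.1 * e₂.symm x.2 ∈ e₃.source}
  smooth_inv : ∀ e ∈ atlas E G, ∀ e' ∈ atlas E G,
    IsBastianiSmooth (fun x => e' (e.symm x)⁻¹) {x | x ∈ e.target ∧ (e.symm x)⁻¹ ∈ e'.source}

/-! ## The topological simplices and their smooth maps -/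

/-- The topological simplex `Δⁿ = {x ∈ ℝⁿ | x_i ≥ 0, ∑ x_i ≤ 1}`. -/
def topSimplex (n : ℕ) : Set (Fin n → ℝ) := {x | (∀ i, 0 ≤ x i) ∧ ∑ i, x i ≤ 1}

/-- A map `Δᵐ → Δⁿ` is smooth iff it extends to a smooth map on an open neighbourhood of `Δᵐ`
in `ℝᵐ`. -/
def IsSmoothSimplexMap {m n : ℕ} (f : topSimplex m → topSimplex n) : Prop :=
  ∃ (V : Set (Fin m → ℝ)) (F : (Fin m → ℝ) → (Fin n → ℝ)),
    IsOpen V ∧ topSimplex m ⊆ V ∧ ContDiffOn ℝ ∞ F V ∧ ∀ x : topSimplex m, F x = f x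

/-- The objects of the category `Δ^sm`: the topological simplices `Δⁿ`. -/
structure SmSimplex : Type where
  dim : ℕ

/-- The morphisms of `Δ^sm`: the smooth maps `Δᵐ → Δⁿ`. -/
@[ext]
structure SmSimplex.Hom (m n : SmSimplex) : Type where
  toFun : topSimplex m.dim → topSimplex n.dim
  smooth : IsSmoothSimplexMap toFun

lemma IsSmoothSimplexMap.id (m : ℕ) :
    IsSmoothSimplexMap (fun x : topSimplex m => x) :=
  ⟨Set.univ, fun x => x, isOpen_univ, Set.subset_univ _, contDiff_id.contDiffOn, fun _ => rfl⟩

lemma IsSmoothSimplexMap.comp {l m n : ℕ} {g : topSimplex m → topSimplex n}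
    {f : topSimplex l → topSimplex m} (hg : IsSmoothSimplexMap g) (hf : IsSmoothSimplexMap f) :
    IsSmoothSimplexMap (fun x => g (f x)) := by
  obtain ⟨V, F, hV, hsub, hF, hFf⟩ := hf
  obtain ⟨W, K, hW, hsub', hK, hKg⟩ := hg
  refine ⟨V ∩ F ⁻¹' W, fun x => K (F x), hF.continuousOn.isOpen_inter_preimage hV hW, ?_, ?_, ?_⟩
  · intro x hx
    refine ⟨hsub hx, ?_⟩
    have h := hFf ⟨x, hx⟩
    simp only at h
    rw [Set.mem_preimage, h]
    exact hsub' (f ⟨x, hx⟩).2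
  · exact hK.comp (hF.mono Set.inter_subset_left) (fun x hx => hx.2)
  · intro x
    rw [← hKg, ← hFf]

/-- The category `Δ^sm` of topological simplices and smooth maps. -/
instance : Category.{0} SmSimplex where
  Hom := SmSimplex.Hom
  id m := ⟨fun x => x, IsSmoothSimplexMap.id m.dim⟩
  comp f g := ⟨fun x => g.toFun (f.toFun x), g.smooth.comp f.smooth⟩

/-- Barycentric coordinates; the vertices of `Δⁿ` are ordered as `0, e_1, …, e_n`. -/
def bary {n : ℕ} (x : Fin n → ℝ) : Fin (n + 1) → ℝ := Fin.cons (1 - ∑ i, x i) x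

/-- The affine map `ℝᵐ → ℝⁿ` that sends the `i`-th vertex of `Δᵐ` to the `θ i`-th vertex of
`Δⁿ`. -/
def affineVertexMap {m n : ℕ} (θ : Fin (m + 1) → Fin (n + 1)) (x : Fin m → ℝ) : Fin n → ℝ :=
  fun j => ∑ i with θ i = j.succ, bary x i

lemma sum_bary {n : ℕ} (x : Fin n → ℝ) : ∑ i, bary x i = 1 := by
  simp [bary, Fin.sum_univ_succ]

lemma bary_affineVertexMap {m n : ℕ} (θ : Fin (m + 1) → Fin (n + 1)) (x : Fin m → ℝ)
    (j : Fin (n + 1)) :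
    bary (affineVertexMap θ x) j = ∑ i with θ i = j, bary x i := by
  refine Fin.cases ?_ (fun j => ?_) j
  · have h := Finset.sum_fiberwise (Finset.univ : Finset (Fin (m + 1))) θ (bary x)
    rw [sum_bary, Fin.sum_univ_succ] at h
    simp only [bary, affineVertexMap, Fin.cons_zero] at h ⊢
    linarith
  · simp [bary, affineVertexMap]

lemma mem_topSimplex_iff {n : ℕ} (x : Fin n → ℝ) : x ∈ topSimplex n ↔ ∀ i, 0 ≤ bary x i := by
  rw [Fin.forall_fin_succ]
  simp [topSimplex, bary, and_comm]

lemma affineVertexMap_mem {m n : ℕ} (θ : Fin (m + 1) → Fin (n + 1)) (x : topSimplex m) :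
    affineVertexMap θ x ∈ topSimplex n := by
  rw [mem_topSimplex_iff]
  intro j
  rw [bary_affineVertexMap]
  exact Finset.sum_nonneg fun i _ => (mem_topSimplex_iff _).1 x.2 i

lemma affineVertexMap_id {n : ℕ} (x : Fin n → ℝ) : affineVertexMap (fun i => i) x = x := by
  ext j
  simp [affineVertexMap, bary, Finset.filter_eq']

lemma affineVertexMap_comp {l m n : ℕ} (θ : Fin (l + 1) → Fin (m + 1))
    (η : Fin (m + 1) → Fin (n + 1)) (x : Fin l → ℝ) :
    affineVertexMap (fun i => η (θ i)) x = affineVertexMap η (affineVertexMap θ x) := by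
  ext j
  change _ = ∑ i with η i = j.succ, bary (affineVertexMap θ x) i
  simp only [bary_affineVertexMap]
  rw [Finset.sum_sigma']
  refine Finset.sum_bij' (fun i _ => ⟨θ i, i⟩) (fun i _ => i.2) ?_ ?_ ?_ ?_ ?_ <;>
    simp +contextual

lemma contDiff_affineVertexMap {m n : ℕ} (θ : Fin (m + 1) → Fin (n + 1)) :
    ContDiff ℝ ∞ (affineVertexMap θ) := by
  rw [contDiff_pi]
  intro j
  refine ContDiff.sum fun i _ => ?_
  refine Fin.cases ?_ (fun i => ?_) i
  · simp only [bary, Fin.cons_zero]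
    fun_prop
  · simp only [bary, Fin.cons_succ]
    fun_prop

/-- The inclusion `Δ → Δ^sm` of the simplex category, which sends `[n]` to `Δⁿ` and a monotone
map to the affine map with these values on the vertices. -/
def simplicialInclusion : SimplexCategory ⥤ SmSimplex where
  obj n := ⟨n.len⟩
  map {m n} θ := SmSimplex.Hom.mk
    (fun x => ⟨affineVertexMap (fun i => θ.toOrderHom i) x, affineVertexMap_mem _ x⟩)
    ⟨Set.univ, affineVertexMap (fun i => θ.toOrderHom i), isOpen_univ, Set.subset_univ _,
      (contDiff_affineVertexMap _).contDiffOn, fun _ => rfl⟩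
  map_id n := by
    apply SmSimplex.Hom.ext
    funext x
    exact Subtype.ext (affineVertexMap_id _)
  map_comp {l m n} θ η := by
    apply SmSimplex.Hom.ext
    funext x
    exact Subtype.ext (affineVertexMap_comp (fun i => θ.toOrderHom i) (fun i => η.toOrderHom i) x)

/-! ## Smooth simplicial sets -/

/-- A smooth simplicial set is a functor `Δ^sm → Set^op`; smooth maps are the natural
transformations. The smooth simplicial set `Δⁿ_•` is `yoneda.obj ⟨n⟩`. -/
abbrev SmoothSSet : Type (t + 1) := SmSimplexᵒᵖ ⥤ Type t

/-- The underlying simplicial set of a smooth simplicial set. -/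
def SmoothSSet.toSSet (X : SmoothSSet.{t}) : SSet.{t} := simplicialInclusion.op ⋙ X

/-! ## Smooth principal bundles over simplices -/

section Bundles

variable (E : Type v) [AddCommGroup E] [Module ℝ E] [TopologicalSpace E]
  (G : Type w) [Group G] [TopologicalSpace G] [ChartedSpace E G]

/-- Smoothness, on an open subset `W` of `ℝⁿ`, of a map to a manifold modelled on `E`. -/
def IsSmoothOnOpen {n : ℕ} (k : (Fin n → ℝ) → G) (W : Set (Fin n → ℝ)) : Prop :=
  ContinuousOn k W ∧
    ∀ e ∈ atlas E G, IsBastianiSmooth (fun x => e (k x)) {x | x ∈ W ∧ k x ∈ e.source}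

/-- Smoothness, on an open subset `S` of the manifold with corners `Δⁿ`, of a map to a manifold
modelled on `E`: near each point of `S` the map extends to a smooth map on an open subset
of `ℝⁿ`. -/
def IsSmoothOnSimplex {n : ℕ} (h : topSimplex n → G) (S : Set (topSimplex n)) : Prop :=
  ∀ x ∈ S, ∃ (W : Set (Fin n → ℝ)) (k : (Fin n → ℝ) → G), IsOpen W ∧ x.1 ∈ W ∧
    IsSmoothOnOpen E G k W ∧ ∀ y ∈ S, y.1 ∈ W → k y.1 = h y

/-- A smooth (right) principal `G`-bundle over `Δⁿ`. Its total space is a set (with any topology),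
and its smooth structure is given by a maximal atlas of `G`-equivariant local trivializations with
smooth transition functions. -/
structure SmoothBundle (n : ℕ) where
  /-- the total space -/
  carrier : ZFSet.{u}
  topology : TopologicalSpace {p : ZFSet.{u} // p ∈ carrier}
  proj : {p : ZFSet.{u} // p ∈ carrier} → topSimplex n
  act : {p : ZFSet.{u} // p ∈ carrier} → G → {p : ZFSet.{u} // p ∈ carrier}
  act_one : ∀ p, act p 1 = p
  act_mul : ∀ p g h, act p (g * h) = act (act p g) h
  proj_act : ∀ p g, proj (act p g) = proj p
  /-- the bundle charts -/
  charts : Set (Bundle.Trivialization G proj)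
  exists_chart : ∀ x, ∃ e ∈ charts, x ∈ e.baseSet
  chart_act : ∀ e ∈ charts, ∀ p, proj p ∈ e.baseSet → ∀ g,
    e (act p g) = ((e p).1, (e p).2 * g)
  smooth_transition : ∀ e ∈ charts, ∀ e' ∈ charts,
    IsSmoothOnSimplex E G (fun x => (e' (e.toOpenPartialHomeomorph.symm (x, 1))).2)
      (e.baseSet ∩ e'.baseSet)
  charts_maximal : ∀ e : Bundle.Trivialization G proj,
    (∀ p, proj p ∈ e.baseSet → ∀ g, e (act p g) = ((e p).1, (e p).2 * g)) →
    (∀ e' ∈ charts,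
      IsSmoothOnSimplex E G (fun x => (e' (e.toOpenPartialHomeomorph.symm (x, 1))).2)
        (e.baseSet ∩ e'.baseSet) ∧
      IsSmoothOnSimplex E G (fun x => (e (e'.toOpenPartialHomeomorph.symm (x, 1))).2)
        (e'.baseSet ∩ e.baseSet)) →
    e ∈ charts

variable {E G}

attribute [instance] SmoothBundle.topology

/-- The points of the total space. -/
abbrev SmoothBundle.Total {n : ℕ} (P : SmoothBundle.{u} E G n) : Type (u + 1) :=
  {p : ZFSet.{u} // p ∈ P.carrier}

/-- Smooth `G`-bundle maps over a given map `f : Δᵐ → Δⁿ`. In bundle charts such a map has the form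
`(x, g) ↦ (f x, h x * g)`, and `h` is required to be smooth. -/
@[ext]
structure BundleMap {m n : ℕ} (f : topSimplex m → topSimplex n)
    (P : SmoothBundle.{u} E G m) (Q : SmoothBundle.{u} E G n) where
  toFun : P.Total → Q.Total
  proj_map : ∀ p, Q.proj (toFun p) = f (P.proj p)
  map_act : ∀ p g, toFun (P.act p g) = Q.act (toFun p) g
  smooth : ∀ e ∈ P.charts, ∀ e' ∈ Q.charts,
    IsSmoothOnSimplex E G (fun x => (e' (toFun (e.toOpenPartialHomeomorph.symm (x, 1)))).2)
      (e.baseSet ∩ f ⁻¹' e'.baseSet)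

variable (E G)

/-! ## Simplicial `G`-bundles -/

/-- A simplicial `G`-bundle over a smooth simplicial set `X`: a functor on the category `Δ^sm(X)`
of smooth simplices of `X`, whose objects are the pairs of `d : Δ^sm` and `x ∈ X(d)` (that is, by
Yoneda, a smooth map `Δ^d_• → X`), and whose morphisms `(c, x) ⟶ (d, y)` are the smooth maps
`f : Δ^c → Δ^d` with `f^* y = x`. It sends a `d`-simplex to a smooth `G`-bundle over `Δ^d`, and a
morphism `f` to a smooth `G`-bundle map over `f`. -/
structure SimplicialBundle (X : SmoothSSet.{t}) where
  obj : ∀ {d : SmSimplex}, X.obj (op d) → SmoothBundle.{u} E G d.dim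
  map : ∀ {c d : SmSimplex} (x : X.obj (op c)) (y : X.obj (op d)) (f : c ⟶ d),
    X.map f.op y = x → BundleMap f.toFun (obj x) (obj y)
  map_id : ∀ {d : SmSimplex} (x : X.obj (op d)) (h : X.map (𝟙 d).op x = x) (p : (obj x).Total),
    (map x x (𝟙 d) h).toFun p = p
  map_comp : ∀ {b c d : SmSimplex} (x : X.obj (op b)) (y : X.obj (op c)) (z : X.obj (op d))
    (f : b ⟶ c) (g : c ⟶ d) (hf : X.map f.op y = x) (hg : X.map g.op z = y)
    (hfg : X.map (f ≫ g).op z = x) (p : (obj x).Total),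
    (map x z (f ≫ g) hfg).toFun p = (map y z g hg).toFun ((map x y f hf).toFun p)

variable {E G}

lemma SmoothSSet.map_app_eq {X Y : SmoothSSet.{t}} (h : Y ⟶ X) {c d : SmSimplex}
    {x : Y.obj (op c)} {y : Y.obj (op d)} {f : c ⟶ d} (hf : Y.map f.op y = x) :
    X.map f.op (h.app (op d) y) = h.app (op c) x := by
  rw [← hf]
  exact (NatTrans.naturality_apply h f.op y).symm

/-- The pull-back `h^* P = P ∘ Δ^sm(h)`. -/
def SimplicialBundle.pullback {X Y : SmoothSSet.{t}} (P : SimplicialBundle.{u} E G X)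
    (h : Y ⟶ X) : SimplicialBundle.{u} E G Y where
  obj x := P.obj (h.app _ x)
  map x y f hf := P.map (h.app _ x) (h.app _ y) f (SmoothSSet.map_app_eq h hf)
  map_id _ _ p := P.map_id _ _ p
  map_comp _ _ _ _ _ _ _ _ p := P.map_comp _ _ _ _ _ _ _ _ p

lemma SimplicialBundle.pullback_id {X : SmoothSSet.{t}} (P : SimplicialBundle.{u} E G X) :
    P.pullback (𝟙 X) = P := rfl

lemma SimplicialBundle.pullback_comp {X Y Z : SmoothSSet.{t}} (P : SimplicialBundle.{u} E G X)
    (h : Y ⟶ X) (k : Z ⟶ Y) : P.pullback (k ≫ h) = (P.pullback h).pullback k := rfl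

/-- `P` is `𝒰`-small if the bundle over each simplex is an element of `𝒰`, that is, if its total
space is. -/
def SimplicialBundle.IsSmall {X : SmoothSSet.{t}} (P : SimplicialBundle.{u} E G X)
    (𝒰 : ZFSet.{u}) : Prop :=
  ∀ {d : SmSimplex} (x : X.obj (op d)), (P.obj x).carrier ∈ 𝒰

variable (E G)

/-- The smooth simplicial set `BG^𝒰`: its `k`-simplices are the `𝒰`-small simplicial `G`-bundles
over `Δᵏ_•`, and `σ : Δᵐ → Δᵏ` acts by pull-back along `σ_• : Δᵐ_• → Δᵏ_•`. -/
def BG (𝒰 : ZFSet.{u}) : SmoothSSet.{max (u + 1) w} where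
  obj k := {P : SimplicialBundle.{u} E G (yoneda.obj k.unop) // P.IsSmall 𝒰}
  map σ := ↾fun P => ⟨P.1.pullback (yoneda.map σ.unop), fun x => P.2 _⟩
  map_id k := by
    ext P
    rfl
  map_comp σ τ := by
    ext P
    rfl

end Bundles

/-! ## Grothendieck universes -/

/-- Grothendieck universes, as sets in the cumulative hierarchy. -/
structure IsGrothendieckUniverse (𝒰 : ZFSet.{u}) : Prop where
  mem_of_mem : ∀ {x y : ZFSet.{u}}, x ∈ 𝒰 → y ∈ x → y ∈ 𝒰
  pair_mem : ∀ {x y : ZFSet.{u}}, x ∈ 𝒰 → y ∈ 𝒰 → ({x, y} : ZFSet.{u}) ∈ 𝒰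
  powerset_mem : ∀ {x : ZFSet.{u}}, x ∈ 𝒰 → x.powerset ∈ 𝒰
  iUnion_mem : ∀ {I : ZFSet.{u}}, I ∈ 𝒰 → ∀ f : {i : ZFSet.{u} // i ∈ I} → ZFSet.{u},
    (∀ i, f i ∈ 𝒰) → ZFSet.iUnion f ∈ 𝒰

/-- The universe `𝒰` contains (a set in bijection with) the type `α`. -/
def UniverseContains (𝒰 : ZFSet.{u}) (α : Type t) : Prop :=
  ∃ D ∈ 𝒰, Nonempty (α ≃ {x : ZFSet.{u} // x ∈ D})

/-- `𝒰` is a `G`-admissible Grothendieck universe: it contains `G` and all the simplices `Δⁿ`. -/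
structure IsAdmissibleUniverse (G : Type w) (𝒰 : ZFSet.{u}) : Prop
    extends IsGrothendieckUniverse 𝒰 where
  contains_group : UniverseContains 𝒰 G
  contains_simplex : ∀ n : ℕ, UniverseContains 𝒰 (topSimplex n)

/-! ## Calculus of Bastiani smooth maps -/

section BastianiBasic

variable {F : Type v} [AddCommGroup F] [Module ℝ F] [TopologicalSpace F]

/-! Let `EG` be the smooth simplicial set of small simplicial bundles over `Δᵏ_•` together with a
compatible family of smooth sections. The map `EG → BG` that forgets the sections is onto, because a
smooth bundle over a simplex has a smooth section, and its fibre over a `d`-simplex is a torsor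
under the group of smooth maps `Δᵈ → G`.

A horn in `BG` gives a family on those smooth maps into `Δⁿ⁺¹` that land in a face opposite to some
vertex `j ≠ k`. The affine map `r j` that moves vertex `j` to vertex `k` and fixes the other
vertices is smooth, though usually not simplicial. It is a retraction onto that face, and the `r j`
commute. So the condition to land in the face reads `x ≫ r j = x`, which makes sense in any
category.

The family lifts to `EG` one face at a time (`exists_family_lift`). On the intersection with the
earlier faces, a lift over the new face differs from the lift found so far by functions with values
in `G`. The commuting retractions extend these functions to the whole new face
(`exists_group_family_extension`), as in Moore's proof that simplicial groups are Kan.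

In the presence of sections, extension is free. There is exactly one bundle map over a given smooth
map that preserves the sections, so an arbitrary assignment of sectioned bundles to simplices is
already functorial (`ofFamily`). The given bundles are kept on the horn, trivial bundles are put
everywhere else (`exists_EG_extension`), and the sections are forgotten. The result restricts to the
horn strictly, not only up to isomorphism.

What remains is analysis: the chain rule for Bastiani maps, which makes smooth maps into `G` a group
stable under precomposition, and the global section `SmoothBundle.exists_smoothSection`, glued slab
by slab. -/

theorem IsBastianiC.continuousOn {k : ℕ} {E : Type u} [AddCommGroup E] [Module ℝ E]
    [TopologicalSpace E] {f : E → F} {U : Set E} (h : IsBastianiC k f U) : ContinuousOn f U := by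
  cases k with
  | zero => exact h
  | succ k => exact h.1

theorem IsBastianiC.mono {k : ℕ} {E : Type u} [AddCommGroup E] [Module ℝ E]
    [TopologicalSpace E] {f : E → F} {U V : Set E} (h : IsBastianiC k f U) (hV : V ⊆ U) :
    IsBastianiC k f V := by
  induction k generalizing E with
  | zero => exact ContinuousOn.mono h hV
  | succ k ih =>
    obtain ⟨hc, df, hd, hk⟩ := h
    exact ⟨hc.mono hV, df, fun x hx v => hd x (hV hx) v, ih hk (Set.prod_mono_left hV)⟩

theorem IsBastianiC.of_succ {k : ℕ} {E : Type u} [AddCommGroup E] [Module ℝ E]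
    [TopologicalSpace E] {f : E → F} {U : Set E} (h : IsBastianiC (k + 1) f U) :
    IsBastianiC k f U := by
  induction k generalizing E with
  | zero => exact h.1
  | succ k ih =>
    obtain ⟨hc, df, hd, hk⟩ := h
    exact ⟨hc, df, hd, ih hk⟩

theorem tendsto_add_smul_nhdsNE {E : Type u} [AddCommGroup E] [Module ℝ E] [TopologicalSpace E]
    [IsTopologicalAddGroup E] [ContinuousSMul ℝ E] (x v : E) :
    Tendsto (fun s : ℝ => x + s • v) (𝓝[≠] 0) (𝓝 x) := by
  have h : Continuous fun s : ℝ => x + s • v := by fun_prop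
  simpa using (h.tendsto 0).mono_left nhdsWithin_le_nhds

theorem IsBastianiC.congr {k : ℕ} {E : Type u} [AddCommGroup E] [Module ℝ E]
    [TopologicalSpace E] [IsTopologicalAddGroup E] [ContinuousSMul ℝ E] {f g : E → F} {U : Set E}
    (h : IsBastianiC k f U) (hU : IsOpen U) (hfg : Set.EqOn g f U) : IsBastianiC k g U := by
  cases k with
  | zero => exact ContinuousOn.congr h hfg
  | succ k =>
    obtain ⟨hc, df, hd, hk⟩ := h
    refine ⟨hc.congr hfg, df, fun x hx v => (hd x hx v).congr' ?_, hk⟩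
    filter_upwards [tendsto_add_smul_nhdsNE x v (hU.mem_nhds hx)] with s hs
    rw [hfg hx, hfg hs]

theorem IsBastianiC.const (k : ℕ) {E : Type u} [AddCommGroup E] [Module ℝ E]
    [TopologicalSpace E] (c : F) (U : Set E) : IsBastianiC k (fun _ : E => c) U := by
  induction k generalizing E c with
  | zero => exact continuousOn_const
  | succ k ih =>
    exact ⟨continuousOn_const, fun _ => 0, fun x _ v => by simpa using tendsto_const_nhds, ih 0 _⟩

theorem IsBastianiC.prodMk {F' : Type w} [AddCommGroup F'] [Module ℝ F'] [TopologicalSpace F']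
    {k : ℕ} {E : Type u} [AddCommGroup E] [Module ℝ E]
    [TopologicalSpace E] {f : E → F} {g : E → F'} {U : Set E} (hf : IsBastianiC k f U)
    (hg : IsBastianiC k g U) : IsBastianiC k (fun x => (f x, g x)) U := by
  induction k generalizing E with
  | zero => exact ContinuousOn.prodMk hf hg
  | succ k ih =>
    obtain ⟨hc, df, hd, hk⟩ := hf
    obtain ⟨hc', df', hd', hk'⟩ := hg
    refine ⟨hc.prodMk hc', fun p => (df p, df' p), fun x hx v => ?_, ih hk hk'⟩
    exact (hd x hx v).prodMk_nhds (hd' x hx v)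

/-- The linear case of the chain rule needs no mean value argument. It is used to regard `f` as a
function on `E × E` in the proof of the general case. -/
theorem IsBastianiC.comp_clm {k : ℕ} {E E' : Type u} [AddCommGroup E] [Module ℝ E]
    [TopologicalSpace E] [AddCommGroup E'] [Module ℝ E'] [TopologicalSpace E']
    {f : E → F} {U : Set E} (hf : IsBastianiC k f U) (L : E' →L[ℝ] E) :
    IsBastianiC k (fun x => f (L x)) (L ⁻¹' U) := by
  induction k generalizing E E' with
  | zero => exact ContinuousOn.comp hf L.continuous.continuousOn fun x hx => hx
  | succ k ih =>
    obtain ⟨hc, df, hd, hk⟩ := hf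
    refine ⟨hc.comp L.continuous.continuousOn fun x hx => hx, fun p => df (L p.1, L p.2),
      fun x hx v => ?_, ?_⟩
    · simpa using hd (L x) hx (L v)
    · exact (ih hk (L.prodMap L)).mono fun p hp => ⟨hp.1, trivial⟩

/-- Limits in the Hausdorff space `F` are unique, so the local differentials agree on overlaps. The
global one uses, at `(x, v)`, the neighbourhood chosen for `x`. -/
theorem isBastianiC_of_forall_exists [T2Space F] {k : ℕ} {E : Type u} [AddCommGroup E] [Module ℝ E]
    [TopologicalSpace E] [IsTopologicalAddGroup E] [ContinuousSMul ℝ E] {f : E → F} {U : Set E}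
    (hU : IsOpen U) (h : ∀ x ∈ U, ∃ V, IsOpen V ∧ x ∈ V ∧ IsBastianiC k f V) :
    IsBastianiC k f U := by
  induction k generalizing E with
  | zero =>
    intro x hx
    obtain ⟨V, hV, hxV, hf⟩ := h x hx
    exact (ContinuousOn.continuousAt hf (hV.mem_nhds hxV)).continuousWithinAt
  | succ k ih =>
    have h' : ∀ x : E, ∃ (V : Set E) (D : E × E → F), x ∈ U → IsOpen V ∧ x ∈ V ∧
        ContinuousOn f V ∧ (∀ x ∈ V, ∀ v : E,
        Tendsto (fun s : ℝ => s⁻¹ • (f (x + s • v) - f x)) (𝓝[≠] 0) (𝓝 (D (x, v)))) ∧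
        IsBastianiC k D (V ×ˢ Set.univ) := by
      intro x
      by_cases hx : x ∈ U
      · obtain ⟨V, hV, hxV, hc, D, hd, hk⟩ := h x hx
        exact ⟨V, D, fun _ => ⟨hV, hxV, hc, hd, hk⟩⟩
      · exact ⟨∅, fun _ => 0, fun h => absurd h hx⟩
    choose V D hVD using h'
    refine ⟨fun x hx => ?_, fun p => D p.1 p, fun x hx v => ?_,
      ih (hU.prod isOpen_univ) fun p hp => ?_⟩
    · obtain ⟨hV, hxV, hc, -⟩ := hVD x hx
      exact (hc.continuousAt (hV.mem_nhds hxV)).continuousWithinAt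
    · obtain ⟨hV, hxV, hc, hd, -⟩ := hVD x hx
      exact hd x hxV v
    · obtain ⟨hV, hxV, hc, hd, hk⟩ := hVD p.1 hp.1
      have ho : IsOpen ((V p.1 ∩ U) ×ˢ (Set.univ : Set E)) := (hV.inter hU).prod isOpen_univ
      refine ⟨_, ho, ⟨⟨hxV, hp.1⟩, trivial⟩,
        (hk.mono (Set.prod_mono_left Set.inter_subset_left)).congr ho fun q hq => ?_⟩
      obtain ⟨-, hqV, -, hd', -⟩ := hVD q.1 hq.1.2
      exact tendsto_nhds_unique (hd' q.1 hqV q.2) (hd q.1 hq.1.1 q.2)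

end BastianiBasic

/-! ### Mean value estimate and chain rule in locally convex spaces -/

section MeanValue

variable {H : Type w} [AddCommGroup H] [Module ℝ H] [TopologicalSpace H]
  [IsTopologicalAddGroup H] [ContinuousSMul ℝ H] [LocallyConvexSpace ℝ H]

theorem exists_closed_convex_mem_nhds {z : H} {U : Set H} (hU : U ∈ 𝓝 z) :
    ∃ C ∈ 𝓝 z, IsClosed C ∧ Convex ℝ C ∧ C ⊆ U := by
  obtain ⟨K, ⟨hK, hKc⟩, hKU⟩ := (closed_nhds_basis z).mem_iff.1 hU
  obtain ⟨C, ⟨hC, hCc⟩, hCK⟩ := (LocallyConvexSpace.convex_basis (𝕜 := ℝ) z).mem_iff.1 hK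
  exact ⟨closure C, mem_of_superset hC subset_closure, isClosed_closure, hCc.closure,
    (closure_minimal hCK hKc).trans hKU⟩

/-- If the slope were outside `C`, a continuous functional would separate it strictly from `C`,
against the scalar mean value theorem for the composite of `γ` with that functional. -/
theorem slope_mem_of_deriv_mem {γ γ' : ℝ → H} {a b : ℝ} (hab : a < b) {C : Set H}
    (hC : IsClosed C) (hC' : Convex ℝ C)
    (hγ : ∀ t ∈ Set.Icc a b,
      Tendsto (fun s : ℝ => s⁻¹ • (γ (t + s) - γ t)) (𝓝[≠] 0) (𝓝 (γ' t)))
    (hm : ∀ t ∈ Set.Icc a b, γ' t ∈ C) : (b - a)⁻¹ • (γ b - γ a) ∈ C := by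
  by_contra hcon
  obtain ⟨l, c, hlt, hgt⟩ := geometric_hahn_banach_closed_point hC' hC hcon
  have hd : ∀ t ∈ Set.Icc a b, HasDerivAt (fun t => l (γ t)) (l (γ' t)) t := by
    intro t ht
    rw [hasDerivAt_iff_tendsto_slope_zero]
    simpa [Function.comp_def] using (l.continuous.tendsto _).comp (hγ t ht)
  obtain ⟨t, ht, heq⟩ := exists_hasDerivAt_eq_slope (fun t => l (γ t)) (fun t => l (γ' t)) hab
    (fun t ht => (hd t ht).continuousAt.continuousWithinAt)
    (fun t ht => hd t (Set.Ioo_subset_Icc_self ht))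
  have h1 := hlt _ (hm t (Set.Ioo_subset_Icc_self ht))
  rw [heq] at h1
  rw [map_smul, map_sub, smul_eq_mul, inv_mul_eq_div] at hgt
  exact lt_asymm h1 hgt

/-- The direction may vary along with the step, as the chain rule requires. By continuity, `dg`
stays in a closed convex neighbourhood of `dg (y, w)` along short segments from `y` in directions
near `w`, so the slopes lie there too. -/
theorem tendsto_differenceQuotient {F : Type v} [AddCommGroup F] [Module ℝ F] [TopologicalSpace F]
    [IsTopologicalAddGroup F] [ContinuousSMul ℝ F] {g : F → H} {V : Set F} (hV : IsOpen V)
    {dg : F × F → H}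
    (hd : ∀ y ∈ V, ∀ w : F,
      Tendsto (fun s : ℝ => s⁻¹ • (g (y + s • w) - g y)) (𝓝[≠] 0) (𝓝 (dg (y, w))))
    (hc : ContinuousOn dg (V ×ˢ Set.univ)) {y : F} (hy : y ∈ V) (w : F) :
    Tendsto (fun p : ℝ × F => p.1⁻¹ • (g (y + p.1 • p.2) - g y)) (𝓝[≠] 0 ×ˢ 𝓝 w)
      (𝓝 (dg (y, w))) := by
  intro U hU
  obtain ⟨C, hC, hCc, hCv, hCU⟩ := exists_closed_convex_mem_nhds hU
  have hcont : Continuous fun p : ℝ × F => (y + p.1 • p.2, p.2) := by fun_prop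
  have hO : IsOpen (V ×ˢ (Set.univ : Set F)) := hV.prod isOpen_univ
  have hyw : (y, w) ∈ V ×ˢ (Set.univ : Set F) := ⟨hy, trivial⟩
  have hN : {q | q ∈ V ×ˢ (Set.univ : Set F) ∧ dg q ∈ C} ∈ 𝓝 (y, w) :=
    inter_mem (hO.mem_nhds hyw) ((hc.continuousAt (hO.mem_nhds hyw)) hC)
  have hev := hcont.tendsto (0, w)
  simp only [zero_smul, add_zero] at hev
  have hev' := hev hN
  rw [mem_map, nhds_prod_eq, mem_prod_iff] at hev'
  obtain ⟨I, hI, N, hNw, hsub⟩ := hev'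
  obtain ⟨ε, hε, hεI⟩ := Metric.mem_nhds_iff.1 hI
  have hkey : ∀ τ : ℝ, |τ| < ε → ∀ w' ∈ N, y + τ • w' ∈ V ∧ dg (y + τ • w', w') ∈ C := by
    intro τ hτ w' hw'
    have := @hsub (τ, w') ⟨hεI (by simpa using hτ), hw'⟩
    exact ⟨this.1.1, this.2⟩
  have hball : Metric.ball (0 : ℝ) ε ∩ {0}ᶜ ∈ 𝓝[≠] (0 : ℝ) :=
    inter_mem (mem_nhdsWithin_of_mem_nhds (Metric.ball_mem_nhds _ hε)) self_mem_nhdsWithin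
  refine mem_map.2 (mem_of_superset (prod_mem_prod hball hNw) ?_)
  rintro ⟨s, w'⟩ ⟨⟨hs, hs0⟩, hw'⟩
  have hs' : |s| < ε := by simpa using hs
  apply hCU
  have hder : ∀ t : ℝ, |t| < ε → Tendsto
      (fun r : ℝ => r⁻¹ • (g (y + (t + r) • w') - g (y + t • w'))) (𝓝[≠] 0)
      (𝓝 (dg (y + t • w', w'))) := by
    intro t ht
    have := hd _ (hkey t ht w' hw').1 w'
    simpa only [add_smul, add_assoc] using this
  rcases lt_or_gt_of_ne (show s ≠ 0 from hs0) with h | h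
  · have hr : ∀ t ∈ Set.Icc s 0, |t| < ε := fun t ht => by
      rw [abs_lt] at hs' ⊢
      exact ⟨by linarith [ht.1], by linarith [ht.2]⟩
    have := slope_mem_of_deriv_mem (γ := fun t => g (y + t • w')) h hCc hCv
      (fun t ht => hder t (hr t ht)) (fun t ht => (hkey t (hr t ht) w' hw').2)
    simpa [← smul_neg, inv_neg] using this
  · have hr : ∀ t ∈ Set.Icc 0 s, |t| < ε := fun t ht => by
      rw [abs_lt] at hs' ⊢
      exact ⟨by linarith [ht.1], by linarith [ht.2]⟩
    have := slope_mem_of_deriv_mem (γ := fun t => g (y + t • w')) h hCc hCv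
      (fun t ht => hder t (hr t ht)) (fun t ht => (hkey t (hr t ht) w' hw').2)
    simpa using this

/-- The chain rule for maps of class `C^k` in the sense of Bastiani. -/
theorem IsBastianiC.comp {k : ℕ} {E : Type u} [AddCommGroup E] [Module ℝ E]
    [TopologicalSpace E]
    {F : Type v} [AddCommGroup F] [Module ℝ F] [TopologicalSpace F]
    [IsTopologicalAddGroup F] [ContinuousSMul ℝ F] {g : F → H} {V : Set F} {f : E → F} {U : Set E}
    (hg : IsBastianiC k g V) (hV : IsOpen V) (hf : IsBastianiC k f U) (hfU : Set.MapsTo f U V) :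
    IsBastianiC k (fun x => g (f x)) U := by
  induction k generalizing E F with
  | zero => exact ContinuousOn.comp hg hf hfU
  | succ k ih =>
    have hfk := hf.of_succ
    obtain ⟨hgc, dg, hgd, hgk⟩ := hg
    obtain ⟨hfc, df, hfd, hk⟩ := hf
    refine ⟨hgc.comp hfc hfU, fun p => dg (f p.1, df p), fun x hx v => ?_, ?_⟩
    -- The difference quotient of `g ∘ f` is that of `g` at `f x`, taken in the direction of the
    -- difference quotient of `f`.
    · have h1 := tendsto_differenceQuotient hV hgd hgk.continuousOn (hfU hx) (df (x, v))
      have h2 : Tendsto (fun s : ℝ => (s, s⁻¹ • (f (x + s • v) - f x))) (𝓝[≠] 0)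
          (𝓝[≠] 0 ×ˢ 𝓝 (df (x, v))) := tendsto_id.prodMk (hfd x hx v)
      refine (h1.comp h2).congr' ?_
      filter_upwards [self_mem_nhdsWithin] with s hs
      have hs : s ≠ 0 := hs
      simp [smul_smul, hs]
    · have h1 : IsBastianiC k (fun p : E × E => f p.1) (U ×ˢ Set.univ) :=
        (hfk.comp_clm (ContinuousLinearMap.fst ℝ E E)).mono fun p hp => hp.1
      exact ih hgk (hV.prod isOpen_univ) (h1.prodMk hk) fun p hp => ⟨hfU hp.1, trivial⟩

end MeanValue

theorem ContDiffOn.isBastianiC {k : ℕ} {E : Type u} {F : Type v} [NormedAddCommGroup E]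
    [NormedSpace ℝ E] [NormedAddCommGroup F] [NormedSpace ℝ F] {f : E → F} {U : Set E}
    (hf : ContDiffOn ℝ ∞ f U) (hU : IsOpen U) : IsBastianiC k f U := by
  induction k generalizing E with
  | zero => exact hf.continuousOn
  | succ k ih =>
    refine ⟨hf.continuousOn, fun p => fderiv ℝ f p.1 p.2, fun x hx v => ?_,
      ih ?_ (hU.prod isOpen_univ)⟩
    · have hd : HasFDerivAt f (fderiv ℝ f x) x :=
        ((hf.contDiffAt (hU.mem_nhds hx)).differentiableAt (by simp)).hasFDerivAt
      exact (hd.hasLineDerivAt v).tendsto_slope_zero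
    · have h1 : ContDiffOn ℝ ∞ (fderiv ℝ f) U := hf.fderiv_of_isOpen hU (by simp)
      exact (h1.comp contDiffOn_fst fun p hp => hp.1).clm_apply contDiffOn_snd

/-! ## Smooth maps to a Fréchet Lie group -/

section SmoothOnOpen

variable {E : Type v} [AddCommGroup E] [Module ℝ E] [UniformSpace E]
  {G : Type w} [TopologicalSpace G] [ChartedSpace E G] {n m : ℕ}

theorem IsSmoothOnOpen.mono {k : (Fin n → ℝ) → G} {W W' : Set (Fin n → ℝ)}
    (h : IsSmoothOnOpen E G k W) (hW : W' ⊆ W) : IsSmoothOnOpen E G k W' :=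
  ⟨h.1.mono hW, fun e he j => (h.2 e he j).mono fun _ hx => ⟨hW hx.1, hx.2⟩⟩

theorem IsSmoothOnOpen.const (c : G) (W : Set (Fin n → ℝ)) :
    IsSmoothOnOpen E G (fun _ : Fin n → ℝ => c) W :=
  ⟨continuousOn_const, fun _ _ _ => IsBastianiC.const _ _ _⟩

theorem IsSmoothOnOpen.isOpen_inter {k : (Fin n → ℝ) → G} {W : Set (Fin n → ℝ)}
    (h : IsSmoothOnOpen E G k W) (hW : IsOpen W) (e : OpenPartialHomeomorph G E) :
    IsOpen {x | x ∈ W ∧ k x ∈ e.source} :=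
  h.1.isOpen_inter_preimage hW e.open_source

variable [IsUniformAddGroup E] [ContinuousSMul ℝ E] [LocallyConvexSpace ℝ E]

theorem IsSmoothOnOpen.comp {k : (Fin n → ℝ) → G} {W : Set (Fin n → ℝ)}
    (h : IsSmoothOnOpen E G k W) (hW : IsOpen W) {F : (Fin m → ℝ) → (Fin n → ℝ)}
    {V : Set (Fin m → ℝ)} (hV : IsOpen V) (hF : ContDiffOn ℝ ∞ F V) :
    IsSmoothOnOpen E G (fun x => k (F x)) (V ∩ F ⁻¹' W) := by
  have hVW := hF.continuousOn.isOpen_inter_preimage hV hW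
  refine ⟨h.1.comp (hF.continuousOn.mono Set.inter_subset_left) fun x hx => hx.2,
    fun e he j => ?_⟩
  exact IsBastianiC.comp (g := fun x => e (k x)) (h.2 e he j) (h.isOpen_inter hW e)
    ((ContDiffOn.isBastianiC hF hV).mono fun x hx => hx.1.1) fun x hx => ⟨hx.1.2, hx.2⟩

variable [T2Space E] [CompleteSpace E] [Group G] [IsTopologicalGroup G] [FrechetLieGroup E G]

theorem IsSmoothOnOpen.mul {k l : (Fin n → ℝ) → G} {W : Set (Fin n → ℝ)} (hW : IsOpen W)
    (hk : IsSmoothOnOpen E G k W) (hl : IsSmoothOnOpen E G l W) :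
    IsSmoothOnOpen E G (fun x => k x * l x) W := by
  have hc : ContinuousOn (fun x => k x * l x) W := hk.1.mul hl.1
  refine ⟨hc, fun e he j => ?_⟩
  have hO : IsOpen {x | x ∈ W ∧ k x * l x ∈ e.source} :=
    hc.isOpen_inter_preimage hW e.open_source
  refine isBastianiC_of_forall_exists hO fun x hx => ?_
  have he₁ := chart_mem_atlas E (k x)
  have he₂ := chart_mem_atlas E (l x)
  set e₁ := chartAt E (k x)
  set e₂ := chartAt E (l x)
  have hV : IsOpen ({y | y ∈ W ∧ k y ∈ e₁.source} ∩ {y | y ∈ W ∧ l y ∈ e₂.source} ∩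
      {x | x ∈ W ∧ k x * l x ∈ e.source}) :=
    ((hk.isOpen_inter hW e₁).inter (hl.isOpen_inter hW e₂)).inter hO
  -- Near `x` the product is the chart expression of the multiplication of `G` composed with `(e₁ ∘
  -- k, e₂ ∘ l)`, so the chain rule applies.
  refine ⟨_, hV, ⟨⟨⟨hx.1, mem_chart_source E _⟩, hx.1, mem_chart_source E _⟩, hx⟩, ?_⟩
  have hM : IsOpen {p : E × E | p.1 ∈ e₁.target ∧ p.2 ∈ e₂.target ∧
      e₁.symm p.1 * e₂.symm p.2 ∈ e.source} := by
    have h1 : ContinuousOn (fun p : E × E => e₁.symm p.1 * e₂.symm p.2)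
        (e₁.target ×ˢ e₂.target) :=
      (e₁.continuousOn_symm.comp continuousOn_fst fun p hp => hp.1).mul
        (e₂.continuousOn_symm.comp continuousOn_snd fun p hp => hp.2)
    convert h1.isOpen_inter_preimage (e₁.open_target.prod e₂.open_target) e.open_source using 1
    ext p
    simp [and_assoc]
  have hf : IsBastianiC j (fun y => (e₁ (k y), e₂ (l y)))
      ({y | y ∈ W ∧ k y ∈ e₁.source} ∩ {y | y ∈ W ∧ l y ∈ e₂.source} ∩
      {x | x ∈ W ∧ k x * l x ∈ e.source}) :=
    ((hk.2 e₁ he₁ j).mono fun y hy => hy.1.1).prodMk ((hl.2 e₂ he₂ j).mono fun y hy => hy.1.2)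
  refine (IsBastianiC.comp
    (FrechetLieGroup.smooth_mul e₁ he₁ e₂ he₂ e he j) hM hf
    fun y hy => ?_).congr hV fun y hy => ?_
  · refine ⟨e₁.map_source hy.1.1.2, e₂.map_source hy.1.2.2, ?_⟩
    simp only [e₁.left_inv hy.1.1.2, e₂.left_inv hy.1.2.2]
    exact hy.2.2
  · simp only [e₁.left_inv hy.1.1.2, e₂.left_inv hy.1.2.2]

theorem IsSmoothOnOpen.inv {k : (Fin n → ℝ) → G} {W : Set (Fin n → ℝ)} (hW : IsOpen W)
    (hk : IsSmoothOnOpen E G k W) : IsSmoothOnOpen E G (fun x => (k x)⁻¹) W := by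
  have hc : ContinuousOn (fun x => (k x)⁻¹) W := hk.1.inv
  refine ⟨hc, fun e he j => ?_⟩
  have hO : IsOpen {x | x ∈ W ∧ (k x)⁻¹ ∈ e.source} :=
    hc.isOpen_inter_preimage hW e.open_source
  refine isBastianiC_of_forall_exists hO fun x hx => ?_
  have he₁ := chart_mem_atlas E (k x)
  set e₁ := chartAt E (k x)
  have hV : IsOpen ({y | y ∈ W ∧ k y ∈ e₁.source} ∩ {x | x ∈ W ∧ (k x)⁻¹ ∈ e.source}) :=
    (hk.isOpen_inter hW e₁).inter hO
  refine ⟨_, hV, ⟨⟨hx.1, mem_chart_source E _⟩, hx⟩, ?_⟩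
  have hM : IsOpen {p : E | p ∈ e₁.target ∧ (e₁.symm p)⁻¹ ∈ e.source} :=
    e₁.continuousOn_symm.inv.isOpen_inter_preimage e₁.open_target e.open_source
  refine (IsBastianiC.comp (FrechetLieGroup.smooth_inv e₁ he₁ e he j) hM
    ((hk.2 e₁ he₁ j).mono fun y hy => hy.1) fun y hy => ?_).congr hV fun y hy => ?_
  · refine ⟨e₁.map_source hy.1.2, ?_⟩
    simp only [e₁.left_inv hy.1.2]
    exact hy.2.2
  · simp only [e₁.left_inv hy.1.2]

end SmoothOnOpen

/-! ### Smooth maps from subsets of a simplex to the group -/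

section SmoothOnSimplex

variable {E : Type v} [AddCommGroup E] [Module ℝ E] [UniformSpace E]
  {G : Type w} [TopologicalSpace G] [ChartedSpace E G] {n m : ℕ}
  {S T : Set (topSimplex n)} {g h : topSimplex n → G}

theorem IsSmoothOnSimplex.mono (hh : IsSmoothOnSimplex E G h S) (hT : T ⊆ S) :
    IsSmoothOnSimplex E G h T := by
  intro x hx
  obtain ⟨W, k, hW, hxW, hk, heq⟩ := hh x (hT hx)
  exact ⟨W, k, hW, hxW, hk, fun y hy => heq y (hT hy)⟩

theorem IsSmoothOnSimplex.congr (hh : IsSmoothOnSimplex E G h S) (hg : Set.EqOn g h S) :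
    IsSmoothOnSimplex E G g S := by
  intro x hx
  obtain ⟨W, k, hW, hxW, hk, heq⟩ := hh x hx
  exact ⟨W, k, hW, hxW, hk, fun y hy hyW => (heq y hy hyW).trans (hg hy).symm⟩

theorem isSmoothOnSimplex_of_forall_exists
    (hh : ∀ x ∈ S, ∃ T, IsOpen T ∧ x ∈ T ∧ IsSmoothOnSimplex E G h (S ∩ T)) :
    IsSmoothOnSimplex E G h S := by
  intro x hx
  obtain ⟨T, hT, hxT, hhT⟩ := hh x hx
  obtain ⟨O, hO, rfl⟩ := isOpen_induced_iff.1 hT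
  obtain ⟨W, k, hW, hxW, hk, heq⟩ := hhT x ⟨hx, hxT⟩
  exact ⟨W ∩ O, k, hW.inter hO, ⟨hxW, hxT⟩, hk.mono Set.inter_subset_left,
    fun y hy hyW => heq y ⟨hy, hyW.2⟩ hyW.1⟩

theorem IsSmoothOnSimplex.const (c : G) (S : Set (topSimplex n)) :
    IsSmoothOnSimplex E G (fun _ => c) S := fun _ _ =>
  ⟨Set.univ, fun _ => c, isOpen_univ, trivial, IsSmoothOnOpen.const c _, fun _ _ _ => rfl⟩

theorem IsSmoothSimplexMap.continuous {f : topSimplex m → topSimplex n}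
    (hf : IsSmoothSimplexMap f) : Continuous f := by
  obtain ⟨V, F, hV, hsub, hF, hFf⟩ := hf
  refine Continuous.subtype_mk (p := fun x => x ∈ topSimplex n) (f := fun x => (f x).1) ?_
    (fun x => (f x).2)
  simp only [← hFf]
  exact hF.continuousOn.comp_continuous continuous_subtype_val fun x => hsub x.2

variable [IsUniformAddGroup E] [ContinuousSMul ℝ E] [LocallyConvexSpace ℝ E]

theorem IsSmoothOnSimplex.comp (hh : IsSmoothOnSimplex E G h S) {f : topSimplex m → topSimplex n}
    (hf : IsSmoothSimplexMap f) : IsSmoothOnSimplex E G (fun x => h (f x)) (f ⁻¹' S) := by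
  intro x hx
  obtain ⟨V, F, hV, hsub, hF, hFf⟩ := hf
  obtain ⟨W, k, hW, hxW, hk, heq⟩ := hh (f x) hx
  refine ⟨V ∩ F ⁻¹' W, fun x => k (F x), hF.continuousOn.isOpen_inter_preimage hV hW,
    ⟨hsub x.2, ?_⟩, hk.comp hW hV hF, fun y hy hyW => ?_⟩
  · rw [Set.mem_preimage, hFf]
    exact hxW
  · have h2 : F y ∈ W := hyW.2
    rw [hFf] at h2
    change k (F y) = h (f y)
    rw [hFf]
    exact heq (f y) hy h2

variable [T2Space E] [CompleteSpace E] [Group G] [IsTopologicalGroup G] [FrechetLieGroup E G]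

theorem IsSmoothOnSimplex.mul (hg : IsSmoothOnSimplex E G g S) (hh : IsSmoothOnSimplex E G h S) :
    IsSmoothOnSimplex E G (fun x => g x * h x) S := by
  intro x hx
  obtain ⟨W, k, hW, hxW, hk, heq⟩ := hg x hx
  obtain ⟨W', k', hW', hxW', hk', heq'⟩ := hh x hx
  exact ⟨W ∩ W', fun y => k y * k' y, hW.inter hW', ⟨hxW, hxW'⟩,
    (hk.mono Set.inter_subset_left).mul (hW.inter hW') (hk'.mono Set.inter_subset_right),
    fun y hy hyW => by simp only [heq y hy hyW.1, heq' y hy hyW.2]⟩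

theorem IsSmoothOnSimplex.inv (hg : IsSmoothOnSimplex E G g S) :
    IsSmoothOnSimplex E G (fun x => (g x)⁻¹) S := by
  intro x hx
  obtain ⟨W, k, hW, hxW, hk, heq⟩ := hg x hx
  exact ⟨W, fun y => (k y)⁻¹, hW, hxW, hk.inv hW, fun y hy hyW => by simp only [heq y hy hyW]⟩

end SmoothOnSimplex

/-! ## Sections of smooth bundles -/

section Sections

variable {E : Type v} [AddCommGroup E] [Module ℝ E] [UniformSpace E]
  {G : Type w} [Group G] [TopologicalSpace G] [ChartedSpace E G]

namespace SmoothBundle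

variable {n m : ℕ} (P : SmoothBundle.{u} E G n)

/-- The unit section of a local trivialization. -/
def chartSection {P : SmoothBundle.{u} E G n} (e : Bundle.Trivialization G P.proj)
    (x : topSimplex n) : P.Total := e.toOpenPartialHomeomorph.symm (x, 1)

variable {P}

theorem proj_chartSection (e : Bundle.Trivialization G P.proj) {x : topSimplex n}
    (hx : x ∈ e.baseSet) : P.proj (chartSection e x) = x :=
  e.proj_symm_apply' hx

theorem chart_chartSection (e : Bundle.Trivialization G P.proj) {x : topSimplex n}
    (hx : x ∈ e.baseSet) : e (chartSection e x) = (x, 1) :=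
  e.apply_symm_apply' hx

theorem ext_of_chart (e : Bundle.Trivialization G P.proj) {p q : P.Total}
    (hp : P.proj p ∈ e.baseSet) (hpq : P.proj p = P.proj q) (h : (e p).2 = (e q).2) : p = q := by
  have hq : P.proj q ∈ e.baseSet := hpq ▸ hp
  refine e.injOn (e.mem_source.2 hp) (e.mem_source.2 hq) (Prod.ext ?_ h)
  exact (e.coe_fst' hp).trans (hpq.trans (e.coe_fst' hq).symm)

theorem chart_act_snd {e : Bundle.Trivialization G P.proj} (he : e ∈ P.charts) {p : P.Total}
    (hp : P.proj p ∈ e.baseSet) (g : G) : (e (P.act p g)).2 = (e p).2 * g := by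
  rw [P.chart_act e he p hp g]

theorem act_injective (p : P.Total) : Function.Injective (P.act p) := by
  intro g h hgh
  obtain ⟨e, he, hx⟩ := P.exists_chart (P.proj p)
  have := congrArg (fun q => (e q).2) hgh
  simpa [chart_act_snd he hx] using this

theorem exists_act_eq {p q : P.Total} (h : P.proj p = P.proj q) : ∃ g, P.act p g = q := by
  obtain ⟨e, he, hx⟩ := P.exists_chart (P.proj p)
  refine ⟨(e p).2⁻¹ * (e q).2, ext_of_chart e ?_ ?_ ?_⟩
  · rwa [P.proj_act]
  · rwa [P.proj_act]
  · rw [chart_act_snd he hx, mul_inv_cancel_left]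

open Classical in
/-- The element of `G` that moves `p` to `q`, for two points of the same fibre. -/
noncomputable def diff (p q : P.Total) : G := if h : ∃ g, P.act p g = q then h.choose else 1

theorem act_diff {p q : P.Total} (h : P.proj p = P.proj q) : P.act p (diff p q) = q := by
  rw [diff, dif_pos (exists_act_eq h)]
  exact (exists_act_eq h).choose_spec

theorem diff_act (p : P.Total) (g : G) : diff p (P.act p g) = g :=
  act_injective p (act_diff (P.proj_act p g).symm)

theorem diff_self (p : P.Total) : diff p p = 1 := by
  simpa [P.act_one] using diff_act p 1

/-- In a chart the difference is expressed by the group operations, which is why the difference of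
two smooth sections is smooth. -/
theorem diff_eq_chart {e : Bundle.Trivialization G P.proj} (he : e ∈ P.charts) {p q : P.Total}
    (hp : P.proj p ∈ e.baseSet) (hpq : P.proj p = P.proj q) :
    diff p q = (e p).2⁻¹ * (e q).2 := by
  have h := congrArg (fun r => (e r).2) (act_diff hpq)
  simp only [chart_act_snd he hp] at h
  rw [← h, inv_mul_cancel_left]

/-- Smooth sections of `P` over a subset of the base. -/
def IsSmoothSection (P : SmoothBundle.{u} E G n) (s : topSimplex n → P.Total)
    (S : Set (topSimplex n)) : Prop :=
  (∀ x ∈ S, P.proj (s x) = x) ∧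
    ∀ e ∈ P.charts, IsSmoothOnSimplex E G (fun x => (e (s x)).2) (S ∩ e.baseSet)

variable {s s' : topSimplex n → P.Total} {S T : Set (topSimplex n)}

theorem IsSmoothSection.mono (hs : P.IsSmoothSection s S) (hT : T ⊆ S) : P.IsSmoothSection s T :=
  ⟨fun x hx => hs.1 x (hT hx), fun e he => (hs.2 e he).mono (Set.inter_subset_inter_left _ hT)⟩

theorem IsSmoothSection.congr (hs : P.IsSmoothSection s S) (h : Set.EqOn s' s S) :
    P.IsSmoothSection s' S :=
  ⟨fun x hx => (h hx) ▸ hs.1 x hx, fun e he => (hs.2 e he).congr fun x hx => by simp only [h hx.1]⟩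

theorem isSmoothSection_of_forall_exists
    (h : ∀ x ∈ S, ∃ T, IsOpen T ∧ x ∈ T ∧ P.IsSmoothSection s (S ∩ T)) :
    P.IsSmoothSection s S := by
  refine ⟨fun x hx => ?_, fun e he => isSmoothOnSimplex_of_forall_exists fun x hx => ?_⟩
  · obtain ⟨T, -, hxT, hT⟩ := h x hx
    exact hT.1 x ⟨hx, hxT⟩
  · obtain ⟨T, hTo, hxT, hT⟩ := h x hx.1
    exact ⟨T, hTo, hxT, (hT.2 e he).mono fun y hy => ⟨⟨hy.1.1, hy.2⟩, hy.1.2⟩⟩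

theorem isSmoothSection_chartSection {e : Bundle.Trivialization G P.proj} (he : e ∈ P.charts) :
    P.IsSmoothSection (chartSection e) e.baseSet :=
  ⟨fun _ hx => proj_chartSection e hx, fun e' he' => P.smooth_transition e he e' he'⟩

variable [IsUniformAddGroup E] [ContinuousSMul ℝ E] [LocallyConvexSpace ℝ E] [T2Space E]
  [CompleteSpace E] [IsTopologicalGroup G] [FrechetLieGroup E G]

theorem IsSmoothSection.act (hs : P.IsSmoothSection s S) {g : topSimplex n → G}
    (hg : IsSmoothOnSimplex E G g S) : P.IsSmoothSection (fun x => P.act (s x) (g x)) S := by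
  refine ⟨fun x hx => by rw [P.proj_act, hs.1 x hx], fun e he => ?_⟩
  refine ((hs.2 e he).mul (hg.mono Set.inter_subset_left)).congr fun x hx => ?_
  exact chart_act_snd he (by rw [hs.1 x hx.1]; exact hx.2) _

theorem IsSmoothSection.diff (hs : P.IsSmoothSection s S) (hs' : P.IsSmoothSection s' S) :
    IsSmoothOnSimplex E G (fun x => diff (s x) (s' x)) S := by
  refine isSmoothOnSimplex_of_forall_exists fun x hx => ?_
  obtain ⟨e, he, hxe⟩ := P.exists_chart x
  refine ⟨e.baseSet, e.open_baseSet, hxe, ((hs.2 e he).inv.mul (hs'.2 e he)).congr fun y hy => ?_⟩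
  refine diff_eq_chart he ?_ ?_
  · rw [hs.1 y hy.1]
    exact hy.2
  · rw [hs.1 y hy.1, hs'.1 y hy.1]

/-- One chart suffices, since there `s` is the unit section of the chart, already known to be
smooth, moved by the smooth function `(e (s x)).2`. -/
theorem isSmoothSection_of_chart {e : Bundle.Trivialization G P.proj} (he : e ∈ P.charts)
    (hS : S ⊆ e.baseSet) (hp : ∀ x ∈ S, P.proj (s x) = x)
    (h : IsSmoothOnSimplex E G (fun x => (e (s x)).2) S) : P.IsSmoothSection s S := by
  refine (((isSmoothSection_chartSection he).mono hS).act h).congr fun x hx => ?_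
  have hx' := hS hx
  refine ext_of_chart e ?_ ?_ ?_
  · rwa [hp x hx]
  · rw [P.proj_act, proj_chartSection e hx', hp x hx]
  · rw [chart_act_snd he (by rwa [proj_chartSection e hx']), chart_chartSection e hx', one_mul]

end SmoothBundle

variable {n m : ℕ}

theorem BundleMap.injOn_fiber {f : topSimplex m → topSimplex n} {P : SmoothBundle.{u} E G m}
    {Q : SmoothBundle.{u} E G n} (F : BundleMap f P Q) {p q : P.Total} (h : P.proj p = P.proj q)
    (hF : F.toFun p = F.toFun q) : p = q := by
  obtain ⟨g, rfl⟩ := SmoothBundle.exists_act_eq h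
  rw [F.map_act] at hF
  have : g = 1 := SmoothBundle.act_injective (F.toFun p) (by rw [← hF, Q.act_one])
  rw [this, P.act_one]

theorem BundleMap.ext_of_section {f : topSimplex m → topSimplex n} {P : SmoothBundle.{u} E G m}
    {Q : SmoothBundle.{u} E G n} {F F' : BundleMap f P Q} {s : topSimplex m → P.Total}
    (hs : ∀ x, P.proj (s x) = x) (h : ∀ x, F.toFun (s x) = F'.toFun (s x)) : F = F' := by
  ext p
  obtain ⟨g, hg⟩ := SmoothBundle.exists_act_eq (hs (P.proj p))
  rw [← hg, F.map_act, F'.map_act, h]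

variable [IsUniformAddGroup E] [ContinuousSMul ℝ E] [LocallyConvexSpace ℝ E] [T2Space E]
  [CompleteSpace E] [IsTopologicalGroup G] [FrechetLieGroup E G]

/-- A bundle map is bijective on fibres, so sections pull back. If it is `(x, g) ↦ (f x, h x * g)`
in charts, the pulled-back section is `h⁻¹` times the coordinate of `s ∘ f`, hence smooth. -/
theorem BundleMap.exists_smoothSection {f : topSimplex m → topSimplex n}
    (hf : IsSmoothSimplexMap f) {P : SmoothBundle.{u} E G m}
    {Q : SmoothBundle.{u} E G n} (F : BundleMap f P Q) {s : topSimplex n → Q.Total}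
    (hs : Q.IsSmoothSection s Set.univ) :
    ∃ s' : topSimplex m → P.Total, P.IsSmoothSection s' Set.univ ∧
      ∀ x, F.toFun (s' x) = s (f x) := by
  have hex : ∀ x, ∃ p, P.proj p = x ∧ F.toFun p = s (f x) := by
    intro x
    obtain ⟨e, he, hx⟩ := P.exists_chart x
    have h1 := SmoothBundle.proj_chartSection e hx
    refine ⟨P.act (SmoothBundle.chartSection e x)
      (SmoothBundle.diff (F.toFun (SmoothBundle.chartSection e x)) (s (f x))), ?_, ?_⟩
    · rw [P.proj_act, h1]
    · rw [F.map_act, SmoothBundle.act_diff]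
      rw [F.proj_map, h1, hs.1 _ trivial]
  choose s' hs' hF using hex
  refine ⟨s', SmoothBundle.isSmoothSection_of_forall_exists fun x _ => ?_, hF⟩
  obtain ⟨e, he, hx⟩ := P.exists_chart x
  obtain ⟨e', he', hx'⟩ := Q.exists_chart (f x)
  refine ⟨e.baseSet ∩ f ⁻¹' e'.baseSet,
    e.open_baseSet.inter (e'.open_baseSet.preimage hf.continuous), ⟨hx, hx'⟩, ?_⟩
  refine SmoothBundle.isSmoothSection_of_chart he (fun y hy => hy.2.1) (fun y _ => hs' y) ?_
  have h1 := F.smooth e he e' he'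
  have h2 := (hs.2 e' he').comp hf
  refine IsSmoothOnSimplex.congr (h1.inv.mul (h2.mono fun y hy => ⟨trivial, hy.2⟩)) ?_ |>.mono
    Set.inter_subset_right
  intro y hy
  have hy1 : P.proj (s' y) ∈ e.baseSet := by rw [hs']; exact hy.1
  have h3 : SmoothBundle.diff (SmoothBundle.chartSection e y) (s' y) = (e (s' y)).2 := by
    rw [SmoothBundle.diff_eq_chart he, SmoothBundle.chart_chartSection e hy.1]
    · simp
    · rw [SmoothBundle.proj_chartSection e hy.1]
      exact hy.1
    · rw [SmoothBundle.proj_chartSection e hy.1, hs']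
  have h4 : P.act (SmoothBundle.chartSection e y) (e (s' y)).2 = s' y := by
    rw [← h3, SmoothBundle.act_diff]
    rw [SmoothBundle.proj_chartSection e hy.1, hs']
  have h5 : (e' (s (f y))).2 =
      (e' (F.toFun (SmoothBundle.chartSection e y))).2 * (e (s' y)).2 := by
    rw [← hF, ← h4, F.map_act, SmoothBundle.chart_act_snd he', h4]
    rw [F.proj_map, SmoothBundle.proj_chartSection e hy.1]
    exact hy.2
  simp only [h5]
  exact (inv_mul_cancel_left _ _).symm

variable (E G) in
/-- A smooth bundle over `Δⁿ` with a global smooth section. -/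
structure SectionedBundle (n : ℕ) where
  bundle : SmoothBundle.{u} E G n
  sec : topSimplex n → bundle.Total
  smooth : bundle.IsSmoothSection sec Set.univ

/-- The unique bundle map over `f` that preserves the chosen sections. -/
noncomputable def SectionedBundle.homOver (P : SectionedBundle.{u} E G m)
    (Q : SectionedBundle.{u} E G n) {f : topSimplex m → topSimplex n}
    (hf : IsSmoothSimplexMap f) : BundleMap f P.bundle Q.bundle where
  toFun p := Q.bundle.act (Q.sec (f (P.bundle.proj p)))
    (SmoothBundle.diff (P.sec (P.bundle.proj p)) p)
  proj_map p := by rw [Q.bundle.proj_act, Q.smooth.1 _ trivial]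
  map_act p g := by
    rw [← Q.bundle.act_mul, P.bundle.proj_act]
    congr 1
    refine SmoothBundle.act_injective (P.sec (P.bundle.proj p)) ?_
    have h := P.smooth.1 (P.bundle.proj p) trivial
    rw [P.bundle.act_mul, SmoothBundle.act_diff, SmoothBundle.act_diff h]
    rw [h, P.bundle.proj_act]
  smooth e he e' he' := by
    have h1 : IsSmoothOnSimplex E G (fun x => (e' (Q.sec (f x))).2)
        (e.baseSet ∩ f ⁻¹' e'.baseSet) :=
      ((Q.smooth.2 e' he').comp hf).mono fun y hy => ⟨trivial, hy.2⟩
    have h2 : IsSmoothOnSimplex E G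
        (fun x => SmoothBundle.diff (P.sec x) (SmoothBundle.chartSection e x))
        (e.baseSet ∩ f ⁻¹' e'.baseSet) :=
      ((P.smooth.mono (Set.subset_univ _)).diff
        (SmoothBundle.isSmoothSection_chartSection he)).mono Set.inter_subset_left
    refine (h1.mul h2).congr fun x hx => ?_
    have h3 := SmoothBundle.proj_chartSection e hx.1
    change (e' (Q.bundle.act (Q.sec (f (P.bundle.proj (SmoothBundle.chartSection e x))))
      (SmoothBundle.diff (P.sec (P.bundle.proj (SmoothBundle.chartSection e x)))
        (SmoothBundle.chartSection e x)))).2 = _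
    rw [h3, SmoothBundle.chart_act_snd he']
    rw [Q.smooth.1 _ trivial]
    exact hx.2

theorem SectionedBundle.homOver_sec (P : SectionedBundle.{u} E G m)
    (Q : SectionedBundle.{u} E G n) {f : topSimplex m → topSimplex n}
    (hf : IsSmoothSimplexMap f) (x : topSimplex m) :
    (P.homOver Q hf).toFun (P.sec x) = Q.sec (f x) := by
  change Q.bundle.act (Q.sec (f (P.bundle.proj (P.sec x)))) _ = _
  rw [P.smooth.1 x trivial, SmoothBundle.diff_self, Q.bundle.act_one]

end Sections

/-! ### The trivial bundle on a prescribed total space -/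

section TrivialBundle

variable {E : Type v} [AddCommGroup E] [Module ℝ E] [UniformSpace E]
  {G : Type w} [Group G] [TopologicalSpace G] [ChartedSpace E G] {n : ℕ}

/-- The global trivialization given by a homeomorphism with the product. -/
def productTrivialization {Z : Type t} [TopologicalSpace Z] (φ : Z ≃ₜ topSimplex n × G) :
    Bundle.Trivialization G (fun z => (φ z).1) where
  toOpenPartialHomeomorph := φ.toOpenPartialHomeomorph
  baseSet := Set.univ
  open_baseSet := isOpen_univ
  source_eq := rfl
  target_eq := by simp
  proj_toFun _ _ := rfl

variable [IsUniformAddGroup E] [ContinuousSMul ℝ E] [LocallyConvexSpace ℝ E] [T2Space E]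
  [CompleteSpace E] [IsTopologicalGroup G] [FrechetLieGroup E G]

variable (E) in
/-- The trivial bundle on a total space that is identified with `Δⁿ × G`. -/
def trivialBundle {C : ZFSet.{u}} (φ : {p : ZFSet.{u} // p ∈ C} ≃ topSimplex n × G) :
    SmoothBundle.{u} E G n :=
  letI τ : TopologicalSpace {p : ZFSet.{u} // p ∈ C} := TopologicalSpace.induced φ inferInstance
  { carrier := C
    topology := τ
    proj := fun z => (φ z).1
    act := fun z g => φ.symm ((φ z).1, (φ z).2 * g)
    act_one := fun p => by simp
    act_mul := fun p g h => by simp [mul_assoc]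
    proj_act := fun p g => by simp
    -- These are all equivariant trivializations that are smooth relative to the product chart
    -- alone. Maximality then follows by comparison with that single chart.
    charts := {e | (∀ p, (φ p).1 ∈ e.baseSet → ∀ g,
        e (φ.symm ((φ p).1, (φ p).2 * g)) = ((e p).1, (e p).2 * g)) ∧
      IsSmoothOnSimplex E G (fun x => (e (φ.symm (x, 1))).2) e.baseSet}
    exists_chart := fun x => by
      refine ⟨productTrivialization (φ.toHomeomorphOfIsInducing ⟨rfl⟩), ⟨fun p _ g => ?_, ?_⟩,
        trivial⟩
      · change φ _ = ((φ p).1, (φ p).2 * g)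
        simp
      · refine (IsSmoothOnSimplex.const (1 : G) _).congr fun x _ => ?_
        change (φ (φ.symm (x, 1))).2 = 1
        simp
    chart_act := fun e he => he.1
    smooth_transition := fun e he e' he' => by
      have h1 := (he.2.mono (Set.inter_subset_left (t := e'.baseSet))).inv
      have h2 := he'.2.mono (Set.inter_subset_right (s := e.baseSet))
      refine (h2.mul h1).congr fun x hx => ?_
      -- By equivariance, the point with coordinate `1` in `e` is the product unit section
      -- translated by the inverse of its `e`-coordinate.
      have key : e.toOpenPartialHomeomorph.symm (x, 1) =
          φ.symm (x, (e (φ.symm (x, 1))).2⁻¹) := by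
        have hx1 : (φ (φ.symm (x, (1 : G)))).1 ∈ e.baseSet := by simpa using hx.1
        have h3 := he.1 (φ.symm (x, 1)) hx1 (e (φ.symm (x, 1))).2⁻¹
        simp only [Equiv.apply_symm_apply, one_mul, mul_inv_cancel] at h3
        rw [e.coe_fst' hx1] at h3
        simp only [Equiv.apply_symm_apply] at h3
        have h4 := e.toOpenPartialHomeomorph.left_inv (x := φ.symm (x, (e (φ.symm (x, 1))).2⁻¹))
          (e.mem_source.2 (by simpa using hx.1))
        rwa [e.coe_coe, h3] at h4
      have hx2 : (φ (φ.symm (x, (1 : G)))).1 ∈ e'.baseSet := by simpa using hx.2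
      have h4 := he'.1 (φ.symm (x, 1)) hx2 (e (φ.symm (x, 1))).2⁻¹
      simp only [Equiv.apply_symm_apply, one_mul] at h4
      simp only [key, h4]
    charts_maximal := fun e he hc => by
      refine ⟨he, ?_⟩
      have h := (hc (productTrivialization (φ.toHomeomorphOfIsInducing ⟨rfl⟩))
        ⟨fun p _ g => ?_, ?_⟩).2
      · exact h.mono fun x hx => ⟨trivial, hx⟩
      · change φ _ = ((φ p).1, (φ p).2 * g)
        simp
      · refine (IsSmoothOnSimplex.const (1 : G) _).congr fun x _ => ?_
        change (φ (φ.symm (x, 1))).2 = 1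
        simp }

variable (E) in
/-- The trivial bundle with its unit section. -/
def trivialSectionedBundle {C : ZFSet.{u}} (φ : {p : ZFSet.{u} // p ∈ C} ≃ topSimplex n × G) :
    SectionedBundle.{u} E G n where
  bundle := trivialBundle E φ
  sec x := φ.symm (x, 1)
  smooth := ⟨fun x _ => congrArg Prod.fst (φ.apply_symm_apply (x, 1)),
    fun _ he => he.2.mono Set.inter_subset_right⟩

end TrivialBundle

/-! ### Total spaces inside the universe -/

section Universe

theorem IsGrothendieckUniverse.prod_mem {𝒰 : ZFSet.{u}} (h : IsGrothendieckUniverse 𝒰)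
    {x y : ZFSet.{u}} (hx : x ∈ 𝒰) (hy : y ∈ 𝒰) : x.prod y ∈ 𝒰 := by
  have hxy : x ∪ y ∈ 𝒰 := by
    have h1 := h.iUnion_mem (h.pair_mem hx hy) (fun i => i.1) fun i => h.mem_of_mem
      (h.pair_mem hx hy) i.2
    convert h1
    ext z
    simp
  -- The product consists of Kuratowski pairs, so it is a subset of the double power set of `x ∪ y`.
  refine h.mem_of_mem (h.powerset_mem (h.powerset_mem (h.powerset_mem hxy))) ?_
  rw [ZFSet.mem_powerset]
  intro z hz
  rw [ZFSet.prod, ZFSet.pairSep, ZFSet.mem_sep] at hz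
  exact hz.1

theorem IsAdmissibleUniverse.exists_equiv {G : Type w} {𝒰 : ZFSet.{u}}
    (h : IsAdmissibleUniverse G 𝒰) (n : ℕ) :
    ∃ C ∈ 𝒰, Nonempty ({p : ZFSet.{u} // p ∈ C} ≃ topSimplex n × G) := by
  obtain ⟨D, hD, ⟨φ⟩⟩ := h.contains_group
  obtain ⟨D', hD', ⟨ψ⟩⟩ := h.contains_simplex n
  refine ⟨D'.prod D, h.toIsGrothendieckUniverse.prod_mem hD' hD,
    ⟨(Equiv.ofBijective (fun q : topSimplex n × G =>
      (⟨ZFSet.pair (ψ q.1).1 (φ q.2).1,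
        ZFSet.pair_mem_prod.2 ⟨(ψ q.1).2, (φ q.2).2⟩⟩ : {p : ZFSet.{u} // p ∈ D'.prod D}))
      ⟨fun p q hpq => ?_, fun q => ?_⟩).symm⟩⟩
  · have := ZFSet.pair_injective (congrArg Subtype.val hpq)
    exact Prod.ext (ψ.injective (Subtype.ext this.1)) (φ.injective (Subtype.ext this.2))
  · obtain ⟨a, ha, b, hb, hab⟩ := ZFSet.mem_prod.1 q.2
    exact ⟨(ψ.symm ⟨a, ha⟩, φ.symm ⟨b, hb⟩), Subtype.ext (by simp [hab])⟩

end Universe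

/-! ## Smooth bundles over simplices have smooth sections -/

section GlobalSection

/-- A smooth function that is the identity on `(-∞, (2c+d)/3]` and maps `(c, ∞)` to `(c, d)`. -/
noncomputable def shrink (c d t : ℝ) : ℝ :=
  t + ((2 * c + d) / 3 - t) * Real.smoothTransition ((t - (2 * c + d) / 3) / ((d - c) / 3))

theorem contDiff_shrink (c d : ℝ) : ContDiff ℝ ∞ (shrink c d) := by
  unfold shrink
  have h : ContDiff ℝ ∞ fun t : ℝ =>
      Real.smoothTransition ((t - (2 * c + d) / 3) / ((d - c) / 3)) :=
    Real.smoothTransition.contDiff.comp ((contDiff_id.sub contDiff_const).div_const _)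
  exact contDiff_id.add ((contDiff_const.sub contDiff_id).mul h)

theorem shrink_of_le {c d t : ℝ} (hcd : c < d) (ht : t ≤ (2 * c + d) / 3) : shrink c d t = t := by
  rw [shrink, Real.smoothTransition.zero_of_nonpos, mul_zero, add_zero]
  exact div_nonpos_of_nonpos_of_nonneg (by linarith) (by linarith)

theorem shrink_mem {c d t : ℝ} (hcd : c < d) (ht : c < t) :
    shrink c d t ∈ Set.Ioo c d ∧ shrink c d t ≤ t := by
  rcases le_total t ((2 * c + d) / 3) with h | h
  · rw [shrink_of_le hcd h]
    exact ⟨⟨ht, by linarith⟩, le_rfl⟩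
  · rcases le_total t ((c + 2 * d) / 3) with h' | h'
    -- On the middle third the value is a convex combination of `t` and `(2 * c + d) / 3`; beyond it
    -- the value is constantly `(2 * c + d) / 3`.
    · have h0 := Real.smoothTransition.nonneg ((t - (2 * c + d) / 3) / ((d - c) / 3))
      have h1 := Real.smoothTransition.le_one ((t - (2 * c + d) / 3) / ((d - c) / 3))
      unfold shrink
      set ψ := Real.smoothTransition ((t - (2 * c + d) / 3) / ((d - c) / 3))
      refine ⟨⟨?_, ?_⟩, ?_⟩ <;> nlinarith
    · have h1 : Real.smoothTransition ((t - (2 * c + d) / 3) / ((d - c) / 3)) = 1 := by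
        apply Real.smoothTransition.one_of_one_le
        rw [one_le_div (by linarith)]
        linarith
      rw [shrink, h1]
      refine ⟨⟨?_, ?_⟩, ?_⟩ <;> linarith

theorem update_mem_topSimplex {n : ℕ} {x : Fin n → ℝ} (hx : x ∈ topSimplex n) (i : Fin n) {r : ℝ}
    (h0 : 0 ≤ r) (hr : r ≤ x i) : Function.update x i r ∈ topSimplex n := by
  refine ⟨fun j => ?_, le_trans (Finset.sum_le_sum fun j _ => ?_) hx.2⟩
  · by_cases h : j = i
    · subst h
      simpa
    · simpa [h] using hx.1 j
  · by_cases h : j = i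
    · subst h
      simpa
    · simp [h]

/-- The map that shrinks the coordinate `i` by `shrink c d`. -/
noncomputable def shrinkCoord {n : ℕ} (i : Fin n) {c d : ℝ} (hc : 0 ≤ c) (hcd : c < d)
    (x : topSimplex n) : topSimplex n :=
  ⟨Function.update x.1 i (shrink c d (x.1 i)), by
    rcases le_or_gt (x.1 i) c with h | h
    · rw [shrink_of_le hcd (by linarith), Function.update_eq_self]
      exact x.2
    · have := shrink_mem hcd h
      exact update_mem_topSimplex x.2 i (hc.trans this.1.1.le) this.2⟩

theorem isSmoothSimplexMap_shrinkCoord {n : ℕ} (i : Fin n) {c d : ℝ} (hc : 0 ≤ c) (hcd : c < d) :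
    IsSmoothSimplexMap (shrinkCoord i hc hcd) := by
  refine ⟨Set.univ, fun x => Function.update x i (shrink c d (x i)), isOpen_univ,
    Set.subset_univ _, ContDiff.contDiffOn ?_, fun _ => rfl⟩
  rw [contDiff_pi]
  intro j
  by_cases h : j = i
  · subst h
    simpa [Function.comp_def] using (contDiff_shrink c d).comp (contDiff_apply ℝ ℝ j)
  · simpa [h] using contDiff_apply ℝ ℝ j

theorem isCompact_topSimplex (n : ℕ) : IsCompact (topSimplex n) := by
  refine (isCompact_Icc (a := (0 : Fin n → ℝ)) (b := 1)).of_isClosed_subset ?_ fun x hx => ?_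
  · have h : topSimplex n = (⋂ i, {x : Fin n → ℝ | 0 ≤ x i}) ∩ {x | ∑ i, x i ≤ 1} := by
      ext x
      simp [topSimplex]
    rw [h]
    exact (isClosed_iInter fun i => isClosed_le continuous_const (continuous_apply i)).inter
      (isClosed_le (by fun_prop) continuous_const)
  · exact ⟨hx.1, fun i =>
      (Finset.single_le_sum (fun j _ => hx.1 j) (Finset.mem_univ i)).trans hx.2⟩

variable {E : Type v} [AddCommGroup E] [Module ℝ E] [UniformSpace E]
  {G : Type w} [Group G] [TopologicalSpace G] [ChartedSpace E G]

namespace SmoothBundle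

variable {n : ℕ} (P : SmoothBundle.{u} E G n)

theorem continuous_coord (i : Fin n) : Continuous fun x : topSimplex n => x.1 i :=
  (continuous_apply i).comp continuous_subtype_val

theorem exists_section_of_subset_ball {δ : ℝ}
    (hδ : ∀ x, ∃ e ∈ P.charts, Metric.ball x δ ⊆ e.baseSet) {S : Set (topSimplex n)}
    (hS : ∀ x ∈ S, S ⊆ Metric.ball x δ) : ∃ s, P.IsSmoothSection s S := by
  by_cases h : ∃ x, x ∈ S
  · obtain ⟨x, hx⟩ := h
    obtain ⟨e, he, hb⟩ := hδ x
    exact ⟨_, (isSmoothSection_chartSection he).mono ((hS x hx).trans hb)⟩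
  -- For empty `S` any section will do; a chart exists because the simplex contains the origin.
  · obtain ⟨e, he, -⟩ := P.exists_chart ⟨0, by simp [topSimplex]⟩
    exact ⟨_, (isSmoothSection_chartSection he).mono fun x hx => absurd ⟨x, hx⟩ h⟩

variable [IsUniformAddGroup E] [ContinuousSMul ℝ E] [LocallyConvexSpace ℝ E] [T2Space E]
  [CompleteSpace E] [IsTopologicalGroup G] [FrechetLieGroup E G]

/-- On the overlap `c < x i < d`, `s₁ = s₂ · g` with `g` smooth. Precomposing `g` with `shrinkCoord`
extends it to all of `c < x i` without changing it for `x i ≤ (2 * c + d) / 3`. After this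
correction of `s₂`, the two sections agree on an open set and glue. Hypothesis `hS` keeps the shrunk
point in `S`. -/
theorem exists_section_glue {S : Set (topSimplex n)} (i : Fin n) {c d : ℝ}
    (hc : 0 ≤ c) (hcd : c < d)
    (hS : ∀ x ∈ S, ∀ y : topSimplex n, (∀ j ≠ i, y.1 j = x.1 j) → y.1 i ≤ x.1 i → y ∈ S)
    (h1 : ∃ s, P.IsSmoothSection s (S ∩ {x | x.1 i < d}))
    (h2 : ∃ s, P.IsSmoothSection s (S ∩ {x | c < x.1 i})) : ∃ s, P.IsSmoothSection s S := by
  classical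
  obtain ⟨s₁, hs₁⟩ := h1
  obtain ⟨s₂, hs₂⟩ := h2
  have hg := (hs₂.mono (T := S ∩ {x | c < x.1 i ∧ x.1 i < d}) fun x hx => ⟨hx.1, hx.2.1⟩).diff
    (hs₁.mono fun x hx => ⟨hx.1, hx.2.2⟩)
  have hgΦ := hg.comp (isSmoothSimplexMap_shrinkCoord i hc hcd)
  have hs₃ := hs₂.act (hgΦ.mono fun x hx => by
    refine ⟨hS x hx.1 _ (fun j hj => ?_) ?_, ?_⟩
    · simp [shrinkCoord, hj]
    · simpa [shrinkCoord] using (shrink_mem hcd hx.2).2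
    · simpa [shrinkCoord] using (shrink_mem hcd hx.2).1)
  set s₃ := fun x => P.act (s₂ x) (diff (s₂ (shrinkCoord i hc hcd x))
    (s₁ (shrinkCoord i hc hcd x))) with hs₃def
  have heq : ∀ x ∈ S, c < x.1 i → x.1 i < (2 * c + d) / 3 → s₃ x = s₁ x := by
    intro x hx hcx hxd
    have hΦ : shrinkCoord i hc hcd x = x := by
      apply Subtype.ext
      simp [shrinkCoord, shrink_of_le hcd hxd.le]
    simp only [hs₃def, hΦ]
    refine act_diff ?_
    rw [hs₂.1 x ⟨hx, hcx⟩, hs₁.1 x ⟨hx, show x.1 i < d by linarith⟩]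
  refine ⟨fun x => if x.1 i < (2 * c + d) / 3 then s₁ x else s₃ x,
    isSmoothSection_of_forall_exists fun x hx => ?_⟩
  by_cases hxi : x.1 i < (2 * c + d) / 3
  · refine ⟨{x | x.1 i < (2 * c + d) / 3}, isOpen_lt (continuous_coord i) continuous_const, hxi,
      (hs₁.mono fun y hy => ⟨hy.1, ?_⟩).congr fun y hy => if_pos hy.2⟩
    have : y.1 i < (2 * c + d) / 3 := hy.2
    change y.1 i < d
    linarith
  · refine ⟨{x | c < x.1 i}, isOpen_lt continuous_const (continuous_coord i), ?_,
      hs₃.congr fun y hy => ?_⟩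
    · change c < x.1 i
      linarith
    · by_cases hyi : y.1 i < (2 * c + d) / 3
      · simp only [if_pos hyi]
        exact (heq y hy.1 hy.2 hyi).symm
      · simp only [if_neg hyi]

/-- Induction on the set `J` of unconstrained coordinates. With none, the set is a box that fits
into one chart in the sup metric. A coordinate is freed by gluing slabs of width `δ` that advance by
`δ / 2`, so that consecutive pieces overlap. -/
theorem exists_section_slab {δ : ℝ} (hδ0 : 0 < δ)
    (hδ : ∀ x, ∃ e ∈ P.charts, Metric.ball x δ ⊆ e.baseSet) (J : Finset (Fin n))
    (a b : Fin n → ℝ) (hab : ∀ j ∉ J, b j - a j ≤ δ) :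
    ∃ s, P.IsSmoothSection s {x | ∀ j ∉ J, a j < x.1 j ∧ x.1 j < b j} := by
  induction J using Finset.induction_on generalizing a b with
  | empty =>
    refine P.exists_section_of_subset_ball hδ fun x hx y hy => ?_
    rw [Metric.mem_ball, Subtype.dist_eq, dist_pi_lt_iff hδ0]
    intro j
    have h1 := hx j (by simp)
    have h2 := hy j (by simp)
    have h3 := hab j (by simp)
    rw [Real.dist_eq, abs_lt]
    constructor <;> linarith
  | insert i J hi ih =>
    set S : Set (topSimplex n) := {x | ∀ j ∉ insert i J, a j < x.1 j ∧ x.1 j < b j} with hSdef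
    have hslab : ∀ r : ℝ, ∃ s, P.IsSmoothSection s
        (S ∩ {x | r < x.1 i ∧ x.1 i < r + δ}) := by
      intro r
      obtain ⟨s, hs⟩ := ih (Function.update a i r) (Function.update b i (r + δ)) fun j hj => by
        by_cases hji : j = i
        · subst hji
          simp
        · simpa [hji] using hab j (by simp [hji, hj])
      refine ⟨s, hs.mono fun x hx j hj => ?_⟩
      by_cases hji : j = i
      · subst hji
        simpa using hx.2
      · simpa [hji] using hx.1 j (by simp [hji, hj])
    have hS : ∀ x ∈ S, ∀ y : topSimplex n, (∀ j ≠ i, y.1 j = x.1 j) → y ∈ S := by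
      intro x hx y hy j hj
      have hji : j ≠ i := fun h => hj (by simp [h])
      rw [hy j hji]
      exact hx j hj
    have hind : ∀ m : ℕ, ∃ s, P.IsSmoothSection s (S ∩ {x | x.1 i < (m + 1) * (δ / 2)}) := by
      intro m
      induction m with
      | zero =>
        -- The slab starts below `0` because its inequality is strict while the coordinate may
        -- vanish.
        obtain ⟨s, hs⟩ := hslab (-(δ / 2))
        refine ⟨s, hs.mono fun x hx => ⟨hx.1, ?_, ?_⟩⟩
        · linarith [x.2.1 i]
        · have : x.1 i < ((0 : ℕ) + 1) * (δ / 2) := hx.2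
          push_cast at this
          linarith
      | succ m ihm =>
        refine P.exists_section_glue i (c := m * (δ / 2)) (d := (m + 1) * (δ / 2))
          (by positivity) (by linarith) ?_ ?_ ?_
        · intro x hx y hy hyx
          exact ⟨hS x hx.1 y hy, lt_of_le_of_lt hyx hx.2⟩
        · obtain ⟨s, hs⟩ := ihm
          exact ⟨s, hs.mono fun x hx => ⟨hx.1.1, hx.2⟩⟩
        · obtain ⟨s, hs⟩ := hslab (m * (δ / 2))
          refine ⟨s, hs.mono fun x hx => ⟨hx.1.1, hx.2, ?_⟩⟩
          have : x.1 i < ((m + 1 : ℕ) + 1) * (δ / 2) := hx.1.2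
          push_cast at this
          linarith
    obtain ⟨m, hm⟩ := exists_nat_gt (1 / (δ / 2))
    obtain ⟨s, hs⟩ := hind m
    refine ⟨s, hs.mono fun x hx => ⟨hx, ?_⟩⟩
    rw [div_lt_iff₀ (by positivity)] at hm
    have hx1 : x.1 i ≤ 1 :=
      (Finset.single_le_sum (fun j _ => x.2.1 j) (Finset.mem_univ i)).trans x.2.2
    change x.1 i < (m + 1) * (δ / 2)
    linarith

/-- A smooth principal bundle over a simplex has a global smooth section. -/
theorem exists_smoothSection : ∃ s, P.IsSmoothSection s Set.univ := by
  obtain ⟨δ, hδ0, hδ⟩ := lebesgue_number_lemma_of_metric (s := (Set.univ : Set (topSimplex n)))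
    (c := fun e : P.charts => e.1.baseSet)
    (isCompact_iff_isCompact_univ.1 (isCompact_topSimplex n)) (fun e => e.1.open_baseSet) (fun x _ => by
      obtain ⟨e, he, hx⟩ := P.exists_chart x
      exact Set.mem_iUnion.2 ⟨⟨e, he⟩, hx⟩)
  -- With every coordinate free, the bounds `0 0` are never consulted.
  obtain ⟨s, hs⟩ := P.exists_section_slab hδ0 (fun x => by
    obtain ⟨e, he⟩ := hδ x trivial
    exact ⟨e.1, e.2, he⟩) Finset.univ 0 0 (by simp)
  exact ⟨s, hs.mono fun x _ => by simp⟩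

end SmoothBundle

end GlobalSection

/-! ## Lifting families along torsors

For idempotent endomorphisms `r i` of `X`, the morphisms `x` to `X` with `x ≫ r i = x` form the
sieve of those that factor through the retract given by `r i`. -/

section Lifting

universe v₁ u₁

variable {C : Type u₁} [Category.{v₁} C] {𝒢 : C → Type w} [∀ d, Group (𝒢 d)]
  (res : ∀ {c d : C}, (c ⟶ d) → 𝒢 d →* 𝒢 c)
  {X : C} {ι : Type*} {r : ι → (X ⟶ X)} (hidem : ∀ i, r i ≫ r i = r i)
  (hcomm : ∀ i j, r i ≫ r j = r j ≫ r i)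

include hidem hcomm in
-- Moore's argument. Multiplying `γ` by `g (x ≫ r j) * (γ (x ≫ r j))⁻¹` makes it equal to `g` on the
-- retract of `r j`. It changes nothing on an earlier retract `l`, since there `x ≫ r j` still lies
-- in `l` by commutativity and the factor is `1`.
theorem exists_group_family_extension (i : ι) (J : Finset ι) (g : ∀ d, (d ⟶ X) → 𝒢 d)
    (hg : ∀ (c d : C) (x : d ⟶ X) (f : c ⟶ d), x ≫ r i = x → (∃ j ∈ J, x ≫ r j = x) →
      g c (f ≫ x) = res f (g d x)) :
    ∃ γ : ∀ d, (d ⟶ X) → 𝒢 d,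
      (∀ (c d : C) (x : d ⟶ X) (f : c ⟶ d), x ≫ r i = x → γ c (f ≫ x) = res f (γ d x)) ∧
      ∀ (d : C) (x : d ⟶ X), x ≫ r i = x → (∃ j ∈ J, x ≫ r j = x) → γ d x = g d x := by
  classical
  induction J using Finset.induction_on with
  | empty => exact ⟨fun _ _ => 1, by simp, by simp⟩
  | insert j J hj ih =>
    obtain ⟨γ, hγ, hγg⟩ := ih fun c d x f hx hxJ => hg c d x f hx <| by
      obtain ⟨l, hl, h⟩ := hxJ
      exact ⟨l, by simp [hl], h⟩
    have hri : ∀ {d : C} (x : d ⟶ X), x ≫ r i = x → (x ≫ r j) ≫ r i = x ≫ r j := by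
      intro d x hx
      rw [Category.assoc, hcomm, ← Category.assoc, hx]
    have hrj : ∀ {d : C} (x : d ⟶ X), (x ≫ r j) ≫ r j = x ≫ r j := by
      intro d x
      rw [Category.assoc, hidem]
    refine ⟨fun d x => g d (x ≫ r j) * (γ d (x ≫ r j))⁻¹ * γ d x, fun c d x f hx => ?_,
      fun d x hx hxJ => ?_⟩
    · simp only [Category.assoc]
      rw [hγ c d x f hx, hγ c d (x ≫ r j) f (hri x hx),
        hg c d (x ≫ r j) f (hri x hx) ⟨j, by simp, hrj x⟩]
      simp
    · by_cases hxj : x ≫ r j = x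
      · simp [hxj]
      · obtain ⟨l, hl, hxl⟩ := hxJ
        have hl' : l ∈ J := (Finset.mem_insert.1 hl).resolve_left fun h => hxj (h ▸ hxl)
        have hrl : (x ≫ r j) ≫ r l = x ≫ r j := by
          rw [Category.assoc, hcomm, ← Category.assoc, hxl]
        simp only [hγg d (x ≫ r j) (hri x hx) ⟨l, hl', hrl⟩, hγg d x hx ⟨l, hl', hxl⟩]
        simp

universe t₁ t₂

variable {Ep : Cᵒᵖ ⥤ Type t₁} {B : Cᵒᵖ ⥤ Type t₂} (q : ∀ {d : C}, Ep.obj (op d) → B.obj (op d))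
  (hq : ∀ {c d : C} (f : c ⟶ d) (e : Ep.obj (op d)), q (Ep.map f.op e) = B.map f.op (q e))
  (hsurj : ∀ {d : C} (b : B.obj (op d)), ∃ e : Ep.obj (op d), q e = b)
  (act : ∀ {d : C}, Ep.obj (op d) → 𝒢 d → Ep.obj (op d))
  (hqact : ∀ {d : C} (e : Ep.obj (op d)) (g : 𝒢 d), q (act e g) = q e)
  (hact : ∀ {c d : C} (f : c ⟶ d) (e : Ep.obj (op d)) (g : 𝒢 d),
    Ep.map f.op (act e g) = act (Ep.map f.op e) (res f g))
  (hfree : ∀ {d : C} (e : Ep.obj (op d)), Function.Injective (act e))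
  (htrans : ∀ {d : C} (e e' : Ep.obj (op d)), q e = q e' → ∃ g, act e g = e')

include hidem hcomm hq hsurj hqact hact hfree htrans in
/-- A family in `B` that is natural on the union of the retracts given by the `r j` lifts to a
family in a torsor over `B`. -/
theorem exists_family_lift (hne : ∀ d : C, Nonempty (Ep.obj (op d)))
    (b : ∀ d, (d ⟶ X) → B.obj (op d))
    (hb : ∀ (c d : C) (x : d ⟶ X) (f : c ⟶ d), (∃ j, x ≫ r j = x) →
      b c (f ≫ x) = B.map f.op (b d x)) (J : Finset ι) :
    ∃ e : ∀ d, (d ⟶ X) → Ep.obj (op d),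
      (∀ (c d : C) (x : d ⟶ X) (f : c ⟶ d), (∃ j ∈ J, x ≫ r j = x) →
        e c (f ≫ x) = Ep.map f.op (e d x)) ∧
      ∀ (d : C) (x : d ⟶ X), (∃ j ∈ J, x ≫ r j = x) → q (e d x) = b d x := by
  classical
  induction J using Finset.induction_on with
  | empty => exact ⟨fun d _ => (hne d).some, by simp, by simp⟩
  | insert i J hi ih =>
    obtain ⟨e, he, hqe⟩ := ih
    -- The retract of `r i` is covered by the single simplex `r i`, so one lift `e₀` of its value
    -- serves the whole retract.
    obtain ⟨e₀, he₀⟩ := hsurj (b X (r i))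
    have hqe₀ : ∀ (d : C) (x : d ⟶ X), x ≫ r i = x → q (Ep.map x.op e₀) = b d x := by
      intro d x hx
      rw [hq, he₀, ← hb d X (r i) x ⟨i, hidem i⟩, hx]
    -- `g` measures the discrepancy between the lift from `e₀` and the earlier lift `e` where both
    -- are defined; it is `1` elsewhere.
    have hex : ∀ (d : C) (x : d ⟶ X), ∃ g : 𝒢 d, x ≫ r i = x → (∃ j ∈ J, x ≫ r j = x) →
        act (Ep.map x.op e₀) g = e d x := by
      intro d x
      by_cases h : x ≫ r i = x ∧ ∃ j ∈ J, x ≫ r j = x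
      · obtain ⟨g, hg⟩ := htrans (Ep.map x.op e₀) (e d x) (by rw [hqe₀ d x h.1, hqe d x h.2])
        exact ⟨g, fun _ _ => hg⟩
      · exact ⟨1, fun h1 h2 => absurd ⟨h1, h2⟩ h⟩
    choose g hg using hex
    have hpre : ∀ {c d : C} {x : d ⟶ X} (f : c ⟶ d), (∃ j ∈ J, x ≫ r j = x) →
        ∃ j ∈ J, (f ≫ x) ≫ r j = f ≫ x := by
      rintro c d x f ⟨j, hj, hx⟩
      exact ⟨j, hj, by rw [Category.assoc, hx]⟩
    obtain ⟨γ, hγ, hγg⟩ := exists_group_family_extension res hidem hcomm i J g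
      fun c d x f hx hxJ => by
        -- Naturality of the discrepancy follows from that of both lifts, because the action is
        -- free.
        apply hfree (Ep.map (f ≫ x).op e₀)
        rw [hg c (f ≫ x) (by rw [Category.assoc, hx]) (hpre f hxJ), he c d x f hxJ,
          ← hg d x hx hxJ, hact]
        simp
    have heq : ∀ (d : C) (x : d ⟶ X), x ≫ r i = x → (∃ j ∈ J, x ≫ r j = x) →
        act (Ep.map x.op e₀) (γ d x) = e d x := by
      intro d x hx hxJ
      rw [hγg d x hx hxJ, hg d x hx hxJ]
    refine ⟨fun d x => if x ≫ r i = x then act (Ep.map x.op e₀) (γ d x) else e d x, ?_, ?_⟩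
    · intro c d x f hxJ
      by_cases hx : x ≫ r i = x
      · have hfx : (f ≫ x) ≫ r i = f ≫ x := by rw [Category.assoc, hx]
        simp only [if_pos hx, if_pos hfx, hγ c d x f hx, hact]
        simp
      · obtain ⟨j, hj, hxj⟩ := hxJ
        have hxJ' : ∃ j ∈ J, x ≫ r j = x :=
          ⟨j, (Finset.mem_insert.1 hj).resolve_left fun h => hx (h ▸ hxj), hxj⟩
        simp only [if_neg hx]
        rw [← he c d x f hxJ']
        -- `x` may lie outside retract `i` while `f ≫ x` lies inside; there the two clauses agree by
        -- `heq`.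
        by_cases hfx : (f ≫ x) ≫ r i = f ≫ x
        · rw [if_pos hfx, heq c _ hfx (hpre f hxJ')]
        · rw [if_neg hfx]
    · intro d x hxJ
      by_cases hx : x ≫ r i = x
      · simp only [if_pos hx, hqact, hqe₀ d x hx]
      · obtain ⟨j, hj, hxj⟩ := hxJ
        simp only [if_neg hx]
        exact hqe d x ⟨j, (Finset.mem_insert.1 hj).resolve_left fun h => hx (h ▸ hxj), hxj⟩

end Lifting

/-! ## Simplicial bundles with sections -/

section SectionedSimplicialBundles

variable (E : Type v) [AddCommGroup E] [Module ℝ E] [UniformSpace E]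
  (G : Type w) [Group G] [TopologicalSpace G] [ChartedSpace E G]

/-- A simplicial `G`-bundle with a compatible family of smooth sections. -/
structure SectionedSimplicialBundle (X : SmoothSSet.{t}) where
  bundle : SimplicialBundle.{u} E G X
  sec : ∀ {d : SmSimplex} (x : X.obj (op d)), topSimplex d.dim → (bundle.obj x).Total
  smooth : ∀ {d : SmSimplex} (x : X.obj (op d)), (bundle.obj x).IsSmoothSection (sec x) Set.univ
  map_sec : ∀ {c d : SmSimplex} (x : X.obj (op c)) (y : X.obj (op d)) (f : c ⟶ d)
    (h : X.map f.op y = x) (p : topSimplex c.dim),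
    (bundle.map x y f h).toFun (sec x p) = sec y (f.toFun p)

variable {E G}

namespace SectionedSimplicialBundle

/-- The pull-back along a smooth map. -/
def pullback {X Y : SmoothSSet.{t}} (S : SectionedSimplicialBundle.{u} E G X) (h : Y ⟶ X) :
    SectionedSimplicialBundle.{u} E G Y where
  bundle := S.bundle.pullback h
  sec x := S.sec (h.app _ x)
  smooth x := S.smooth (h.app _ x)
  map_sec _ _ f hf p := S.map_sec _ _ f (SmoothSSet.map_app_eq h hf) p

/-- The bundle with section over a single simplex. -/
def value {X : SmoothSSet.{t}} (S : SectionedSimplicialBundle.{u} E G X)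
    {d : SmSimplex} (x : X.obj (op d)) : SectionedBundle.{u} E G d.dim :=
  ⟨S.bundle.obj x, S.sec x, S.smooth x⟩

variable {X : SmoothSSet.{t}}

theorem mk_congr_map
    {obj : ∀ {d : SmSimplex}, X.obj (op d) → SmoothBundle.{u} E G d.dim}
    {map map' : ∀ {c d : SmSimplex} (x : X.obj (op c)) (y : X.obj (op d)) (f : c ⟶ d),
      X.map f.op y = x → BundleMap f.toFun (obj x) (obj y)} {hid hid' hcomp hcomp'}
    {sec : ∀ {d : SmSimplex} (x : X.obj (op d)), topSimplex d.dim → (obj x).Total}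
    {hsec hmap hmap'} (h : @map = @map') :
    (⟨⟨obj, map, hid, hcomp⟩, sec, hsec, hmap⟩ : SectionedSimplicialBundle.{u} E G X) =
      ⟨⟨obj, map', hid', hcomp'⟩, sec, hsec, hmap'⟩ := by
  subst h
  rfl

theorem mk_congr_sec {R : SimplicialBundle.{u} E G X}
    {sec sec' : ∀ {d : SmSimplex} (x : X.obj (op d)), topSimplex d.dim → (R.obj x).Total}
    {hsec hsec' hmap hmap'} (h : @sec = @sec') :
    (⟨R, sec, hsec, hmap⟩ : SectionedSimplicialBundle.{u} E G X) = ⟨R, sec', hsec', hmap'⟩ := by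
  subst h
  rfl

end SectionedSimplicialBundle

variable [IsUniformAddGroup E] [ContinuousSMul ℝ E] [LocallyConvexSpace ℝ E] [T2Space E]
  [CompleteSpace E] [IsTopologicalGroup G] [FrechetLieGroup E G]

variable (E G) in
/-- The group of smooth maps from a simplex to `G`. -/
def smoothMaps (d : SmSimplex) : Subgroup (topSimplex d.dim → G) where
  carrier := {g | IsSmoothOnSimplex E G g Set.univ}
  mul_mem' hg hh := hg.mul hh
  one_mem' := IsSmoothOnSimplex.const (1 : G) _
  inv_mem' hg := hg.inv

/-- Precomposition with a smooth map of simplices. -/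
def smoothMapsComp {c d : SmSimplex} (f : c ⟶ d) : smoothMaps E G d →* smoothMaps E G c where
  toFun g := ⟨fun x => g.1 (f.toFun x), IsSmoothOnSimplex.comp g.2 f.smooth⟩
  map_one' := rfl
  map_mul' _ _ := rfl

namespace SectionedSimplicialBundle

variable {X : SmoothSSet.{t}}

/-- A family of bundles with sections determines a simplicial bundle with sections, since a bundle
map over a given map is determined by its values on a section. -/
noncomputable def ofFamily
    (F : ∀ {d : SmSimplex}, X.obj (op d) → SectionedBundle.{u} E G d.dim) :
    SectionedSimplicialBundle.{u} E G X where
  bundle :=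
    { obj := fun x => (F x).bundle
      map := fun x y f _ => (F x).homOver (F y) f.smooth
      map_id := fun x h p => by
        have hx := (F x).smooth.1 ((F x).bundle.proj p) trivial
        have hp := SmoothBundle.act_diff hx
        rw [← hp, BundleMap.map_act, SectionedBundle.homOver_sec]
        rfl
      map_comp := fun x y z f g _ _ _ p => by
        have hx := (F x).smooth.1 ((F x).bundle.proj p) trivial
        have hp := SmoothBundle.act_diff hx
        rw [← hp, BundleMap.map_act, BundleMap.map_act, BundleMap.map_act,
          SectionedBundle.homOver_sec, SectionedBundle.homOver_sec, SectionedBundle.homOver_sec]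
        rfl }
  sec x := (F x).sec
  smooth x := (F x).smooth
  map_sec x y f _ p := SectionedBundle.homOver_sec (F x) (F y) f.smooth p

theorem ofFamily_value (S : SectionedSimplicialBundle.{u} E G X) :
    ofFamily (fun x => S.value x) = S := by
  obtain ⟨⟨obj, map, map_id, map_comp⟩, sec, smooth, map_sec⟩ := S
  refine mk_congr_map ?_
  funext c d x y f hf
  refine BundleMap.ext_of_section (s := sec x) (fun p => (smooth x).1 p trivial) fun p => ?_
  exact (SectionedBundle.homOver_sec (⟨obj x, sec x, smooth x⟩)
    ⟨obj y, sec y, smooth y⟩ f.smooth p).trans (map_sec x y f hf p).symm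

/-- The structure maps are forced by the sections, so equality can be tested on one simplex at a
time, with no comparison of bundle maps between varying types. -/
theorem ext_value {S S' : SectionedSimplicialBundle.{u} E G X}
    (h : ∀ {d : SmSimplex} (x : X.obj (op d)), S.value x = S'.value x) : S = S' := by
  rw [← ofFamily_value S, ← ofFamily_value S']
  congr 1
  funext d x
  exact h x

variable {d : SmSimplex}

/-- The right action of smooth maps to `G` on the sections. -/
def act (S : SectionedSimplicialBundle.{u} E G (yoneda.obj d)) (g : smoothMaps E G d) :
    SectionedSimplicialBundle.{u} E G (yoneda.obj d) where
  bundle := S.bundle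
  sec {c} x p := (S.bundle.obj x).act (S.sec x p) (g.1 (SmSimplex.Hom.toFun x p))
  smooth {c} x := (S.smooth x).act (IsSmoothOnSimplex.comp g.2 (SmSimplex.Hom.smooth x))
  map_sec {b c} x y f h p := by
    rw [BundleMap.map_act, S.map_sec]
    subst h
    rfl

theorem act_injective (S : SectionedSimplicialBundle.{u} E G (yoneda.obj d)) :
    Function.Injective S.act := by
  intro g g' h
  refine Subtype.ext (funext fun p => ?_)
  -- `HEq` is needed since the type of a section depends on the underlying bundle. After the
  -- rewriting both sides live in the same fibre of `S.bundle`.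
  have h1 : ∀ S' : SectionedSimplicialBundle.{u} E G (yoneda.obj d), S.act g = S' →
      HEq ((S.act g).sec (𝟙 d) p) (S'.sec (𝟙 d) p) := by
    rintro _ rfl
    rfl
  exact SmoothBundle.act_injective _ (eq_of_heq (h1 _ h))

/-- The difference is read off over the identity simplex. Every other simplex `x` maps to it by
`R.map x (𝟙 d) x rfl`, which is injective on fibres. -/
theorem exists_act_eq {S S' : SectionedSimplicialBundle.{u} E G (yoneda.obj d)}
    (h : S.bundle = S'.bundle) : ∃ g, S.act g = S' := by
  obtain ⟨R, s, hs, hms⟩ := S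
  obtain ⟨R', s', hs', hms'⟩ := S'
  obtain rfl : R = R' := h
  refine ⟨⟨fun p => SmoothBundle.diff (s (𝟙 d) p) (s' (𝟙 d) p), (hs (𝟙 d)).diff (hs' (𝟙 d))⟩, ?_⟩
  refine mk_congr_sec ?_
  funext c x p
  refine BundleMap.injOn_fiber (R.map x (𝟙 d) x rfl) ?_ ?_
  · exact (SmoothBundle.proj_act _ _ _).trans (((hs x).1 p trivial).trans ((hs' x).1 p trivial).symm)
  · refine (BundleMap.map_act _ _ _).trans ?_
    rw [hms, hms', SmoothBundle.act_diff]
    rw [(hs _).1 _ trivial, (hs' _).1 _ trivial]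

/-- A section over the identity simplex determines all others by pull-back. Their compatibility
holds after mapping to the identity simplex, hence before, by injectivity on fibres. -/
theorem exists_bundle_eq (R : SimplicialBundle.{u} E G (yoneda.obj d)) :
    ∃ S : SectionedSimplicialBundle.{u} E G (yoneda.obj d), S.bundle = R := by
  obtain ⟨s₀, hs₀⟩ := (R.obj (𝟙 d)).exists_smoothSection
  have hex : ∀ {c : SmSimplex} (x : (yoneda.obj d).obj (op c)),
      ∃ s' : topSimplex c.dim → (R.obj x).Total, (R.obj x).IsSmoothSection s' Set.univ ∧
        ∀ p, (R.map x (𝟙 d) x rfl).toFun (s' p) = s₀ (SmSimplex.Hom.toFun x p) := fun x =>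
    BundleMap.exists_smoothSection (SmSimplex.Hom.smooth x) (R.map x (𝟙 d) x rfl) hs₀
  choose s hs hms using @hex
  refine ⟨⟨R, @s, @hs, fun {b c} x y f h p => ?_⟩, rfl⟩
  refine BundleMap.injOn_fiber (R.map y (𝟙 d) y rfl) ?_ ?_
  · rw [BundleMap.proj_map, (hs x).1 p trivial, (hs y).1 _ trivial]
  · rw [hms, ← R.map_comp x y (𝟙 d) f y h rfl h]
    subst h
    exact hms _ p

end SectionedSimplicialBundle

variable (E G) in
/-- The smooth simplicial set of `𝒰`-small simplicial bundles with sections. -/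
def EG (𝒰 : ZFSet.{u}) : SmoothSSet.{max (u + 1) w} where
  obj k := {S : SectionedSimplicialBundle.{u} E G (yoneda.obj k.unop) // S.bundle.IsSmall 𝒰}
  map σ := ↾fun S => ⟨S.1.pullback (yoneda.map σ.unop), fun _ => S.2 _⟩
  map_id k := by
    ext S
    rfl
  map_comp σ τ := by
    ext S
    rfl

/-- `H` is a sieve, so the given bundles can be kept on it and trivial ones put elsewhere; the
bundle maps between the two kinds come from the sections. -/
theorem exists_EG_extension {𝒰 : ZFSet.{u}} (h𝒰 : IsAdmissibleUniverse G 𝒰) {X : SmSimplex}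
    (H : ∀ d, (d ⟶ X) → Prop)
    (hH : ∀ (c d : SmSimplex) (x : d ⟶ X) (f : c ⟶ d), H d x → H c (f ≫ x))
    (e : ∀ d, (d ⟶ X) → (EG E G 𝒰).obj (op d))
    (he : ∀ (c d : SmSimplex) (x : d ⟶ X) (f : c ⟶ d), H d x →
      e c (f ≫ x) = (EG E G 𝒰).map f.op (e d x)) :
    ∃ S : (EG E G 𝒰).obj (op X), ∀ (d : SmSimplex) (x : d ⟶ X), H d x →
      (EG E G 𝒰).map x.op S = e d x := by
  classical
  choose C hC φ using fun n => h𝒰.exists_equiv n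
  let F : ∀ {d : SmSimplex}, (yoneda.obj X).obj (op d) → SectionedBundle.{u} E G d.dim :=
    fun {d} x => if H d x then (e d x).1.value (𝟙 d) else trivialSectionedBundle E (φ d.dim).some
  refine ⟨⟨SectionedSimplicialBundle.ofFamily @F, fun {d} x => ?_⟩, fun d x hx => ?_⟩
  · change (F x).bundle.carrier ∈ 𝒰
    by_cases h : H d x
    · simp only [F, if_pos h]
      exact (e d x).2 _
    · simp only [F, if_neg h]
      exact hC _
  · refine Subtype.ext (SectionedSimplicialBundle.ext_value fun {c} f => ?_)
    change F (f ≫ x) = (e d x).1.value f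
    have hfx := hH c d x f hx
    simp only [F, if_pos hfx]
    -- Naturality identifies the bundle over the identity for `f ≫ x` with the one that `e d x`
    -- assigns to `f`.
    rw [he c d x f hx]
    rfl

end SectionedSimplicialBundles

/-! ## Horns -/

section Horns

/-- The smooth map of simplices that is affine with the given values on the vertices. -/
def affineHom {m n : ℕ} (θ : Fin (m + 1) → Fin (n + 1)) : (⟨m⟩ : SmSimplex) ⟶ ⟨n⟩ :=
  SmSimplex.Hom.mk (fun x => ⟨affineVertexMap θ x, affineVertexMap_mem θ x⟩)
    ⟨Set.univ, affineVertexMap θ, isOpen_univ, Set.subset_univ _,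
      (contDiff_affineVertexMap _).contDiffOn, fun _ => rfl⟩

theorem affineHom_comp {l m n : ℕ} (θ : Fin (l + 1) → Fin (m + 1))
    (η : Fin (m + 1) → Fin (n + 1)) :
    affineHom θ ≫ affineHom η = affineHom fun i => η (θ i) := by
  apply SmSimplex.Hom.ext
  funext x
  exact Subtype.ext (affineVertexMap_comp θ η x).symm

theorem affineHom_id (n : ℕ) : affineHom (fun i : Fin (n + 1) => i) = 𝟙 (⟨n⟩ : SmSimplex) := by
  apply SmSimplex.Hom.ext
  funext x
  exact Subtype.ext (affineVertexMap_id _)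

/-- The cosimplicial identity for two coface maps, read on vertices. -/
theorem succAbove_succAbove_pred {n : ℕ} {i j : Fin (n + 3)} (hij : i < j) (a : Fin (n + 1)) :
    i.succAbove ((j.pred (Fin.ne_zero_of_lt hij)).succAbove a) =
      j.succAbove ((i.castPred (Fin.ne_last_of_lt hij)).succAbove a) := by
  obtain ⟨i, rfl⟩ := i.eq_castSucc_of_ne_last (Fin.ne_last_of_lt hij)
  obtain ⟨j, rfl⟩ := j.eq_succ_of_ne_zero (Fin.ne_zero_of_lt hij)
  have h := SimplexCategory.δ_comp_δ (i := i) (j := j) (by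
    rw [Fin.le_def]
    have := Fin.lt_def.1 hij
    simp at this
    omega)
  have h' := congrArg (fun f => f.toOrderHom a) h
  exact h'.symm

/-- Faces of a presheaf on `Δ^sm` that are compatible along the common faces of codimension one
have the same values on the smooth simplices that lie in two of them. -/
theorem map_eq_map_of_compatible {B : SmoothSSet.{t}} {n : ℕ} {k : Fin (n + 3)}
    {π : Fin (n + 3) → Fin (n + 3) → Fin (n + 2)}
    (hπ : ∀ j ≠ k, ∀ v, j.succAbove (π j v) = if v = j then k else v)
    (b : ∀ j ≠ k, B.obj (op ⟨n + 1⟩)) {i j : Fin (n + 3)} (hi : i ≠ k) (hj : j ≠ k) (hij : i < j)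
    (hb : B.map (affineHom (j.pred (Fin.ne_zero_of_lt hij)).succAbove).op (b i hi) =
      B.map (affineHom (i.castPred (Fin.ne_last_of_lt hij)).succAbove).op (b j hj))
    {d : SmSimplex} (x : d ⟶ ⟨n + 2⟩)
    (hxi : x ≫ affineHom (fun v => if v = i then k else v) = x)
    (hxj : x ≫ affineHom (fun v => if v = j then k else v) = x) :
    B.map (x ≫ affineHom (π i)).op (b i hi) = B.map (x ≫ affineHom (π j)).op (b j hj) := by
  -- Moving `j` and then `i` to `k` never yields `j`. So `π i`, after moving `j` to `k`, takes
  -- values in the common face of faces `i` and `j`, and `ζ` gives the vertices there.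
  have hex : ∀ v : Fin (n + 3), ∃ a : Fin (n + 1),
      (j.pred (Fin.ne_zero_of_lt hij)).succAbove a = π i (if v = j then k else v) := by
    intro v
    apply Fin.exists_succAbove_eq
    intro h
    have h1 := congrArg i.succAbove h
    rw [hπ i hi, Fin.succAbove_of_le_castSucc _ _ (by
      rw [Fin.le_def]
      have := Fin.lt_def.1 hij
      simp
      omega), Fin.succ_pred] at h1
    split_ifs at h1 with h2 h3 h4
    exacts [hj h1.symm, hj h1.symm, hj h1.symm, h2 h1]
  choose ζ hζ using hex
  have hxy : (x ≫ affineHom ζ) ≫ affineHom (j.pred (Fin.ne_zero_of_lt hij)).succAbove =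
      x ≫ affineHom (π i) := by
    rw [Category.assoc, affineHom_comp]
    simp only [hζ]
    rw [← affineHom_comp (fun v => if v = j then k else v) (π i), ← Category.assoc, hxj]
  -- `π l` is a left inverse of the inclusion of face `l`.
  have hret : ∀ l ≠ k, ∀ {m : ℕ} (θ : Fin (m + 1) → Fin (n + 2)),
      affineHom (fun v => l.succAbove (θ v)) ≫ affineHom (π l) = affineHom θ := by
    intro l hl m θ
    rw [affineHom_comp]
    congr 1
    funext v
    apply Fin.succAbove_right_injective (p := l)
    rw [hπ l hl, if_neg (Fin.succAbove_ne l _)]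
  have hxy' : (x ≫ affineHom ζ) ≫ affineHom (i.castPred (Fin.ne_last_of_lt hij)).succAbove =
      x ≫ affineHom (π j) := by
    rw [Category.assoc, affineHom_comp, ← hret j hj, ← Category.assoc]
    congr 1
    simp only [← succAbove_succAbove_pred hij, hζ, hπ i hi]
    rw [← affineHom_comp (fun v => if v = j then k else v) (fun v => if v = i then k else v),
      ← Category.assoc, hxj, hxi]
  rw [← hxy, ← hxy']
  simp only [op_comp, Functor.map_comp, types_comp_apply, hb]

end Horns

/-! ### Extension in `BG` and the Kan condition -/

variable {E : Type v} [AddCommGroup E] [Module ℝ E] [UniformSpace E]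
  {G : Type w} [Group G] [TopologicalSpace G] [ChartedSpace E G]
  [IsUniformAddGroup E] [ContinuousSMul ℝ E] [LocallyConvexSpace ℝ E] [T2Space E]
  [CompleteSpace E] [IsTopologicalGroup G] [FrechetLieGroup E G]

theorem nonempty_EG {𝒰 : ZFSet.{u}} (h𝒰 : IsAdmissibleUniverse G 𝒰) (d : SmSimplex) :
    Nonempty ((EG E G 𝒰).obj (op d)) := by
  choose C hC φ using fun n => h𝒰.exists_equiv n
  exact ⟨⟨SectionedSimplicialBundle.ofFamily
    fun {c} _ => trivialSectionedBundle E (φ c.dim).some, fun _ => hC _⟩⟩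

/-- A family in `BG` that is natural on the union of the images of commuting idempotents extends. -/
theorem exists_BG_extension {𝒰 : ZFSet.{u}} (h𝒰 : IsAdmissibleUniverse G 𝒰) {X : SmSimplex}
    {ι : Type} [Fintype ι] {r : ι → (X ⟶ X)} (hidem : ∀ i, r i ≫ r i = r i)
    (hcomm : ∀ i j, r i ≫ r j = r j ≫ r i) (b : ∀ d, (d ⟶ X) → (BG E G 𝒰).obj (op d))
    (hb : ∀ (c d : SmSimplex) (x : d ⟶ X) (f : c ⟶ d), (∃ j, x ≫ r j = x) →
      b c (f ≫ x) = (BG E G 𝒰).map f.op (b d x)) :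
    ∃ P : (BG E G 𝒰).obj (op X), ∀ (d : SmSimplex) (x : d ⟶ X), (∃ j, x ≫ r j = x) →
      (BG E G 𝒰).map x.op P = b d x := by
  have hsurj : ∀ {d : SmSimplex} (R : (BG E G 𝒰).obj (op d)),
      ∃ S : (EG E G 𝒰).obj (op d), (⟨S.1.bundle, S.2⟩ : (BG E G 𝒰).obj (op d)) = R := by
    rintro d ⟨R, hR⟩
    obtain ⟨S, rfl⟩ := SectionedSimplicialBundle.exists_bundle_eq R
    exact ⟨⟨S, hR⟩, rfl⟩
  obtain ⟨e, he, hqe⟩ := exists_family_lift (fun {c d} f => smoothMapsComp (E := E) (G := G) f)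
    hidem hcomm (Ep := EG E G 𝒰) (B := BG E G 𝒰) (fun S => ⟨S.1.bundle, S.2⟩)
    (fun _ _ => rfl) hsurj (fun S g => ⟨S.1.act g, S.2⟩) (fun _ _ => rfl) (fun _ _ _ => rfl)
    (fun S g g' h => S.1.act_injective (congrArg Subtype.val h))
    (fun S S' h => by
      obtain ⟨g, hg⟩ := SectionedSimplicialBundle.exists_act_eq
        (S := S.1) (S' := S'.1) (congrArg Subtype.val h)
      exact ⟨g, Subtype.ext hg⟩)
    (nonempty_EG h𝒰) b hb Finset.univ
  obtain ⟨S, hS⟩ := exists_EG_extension h𝒰 (fun d x => ∃ j ∈ Finset.univ, x ≫ r j = x)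
    (fun c d x f ⟨j, hj, hx⟩ => ⟨j, hj, by rw [Category.assoc, hx]⟩) e he
  refine ⟨⟨S.1.bundle, S.2⟩, fun d x ⟨j, hx⟩ => ?_⟩
  rw [← hqe d x ⟨j, Finset.mem_univ j, hx⟩, ← hS d x ⟨j, Finset.mem_univ j, hx⟩]
  rfl

theorem mainTheorem7 {E : Type v} [AddCommGroup E] [Module ℝ E] [UniformSpace E]
    [IsUniformAddGroup E] [ContinuousSMul ℝ E] [LocallyConvexSpace ℝ E] [T2Space E]
    [CompleteSpace E]
    {G : Type w} [Group G] [TopologicalSpace G] [IsTopologicalGroup G] [ChartedSpace E G]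
    [FrechetLieGroup E G]
    (𝒰 : ZFSet.{u}) (h𝒰 : IsAdmissibleUniverse G 𝒰) :
    SSet.KanComplex (BG E G 𝒰).toSSet := by
  classical
  rw [SSet.KanComplex.iff]
  intro n k f hf
  -- `π j` is the retraction onto face `j` in the coordinates of that face, sending vertex `j` to
  -- `k`; its values for `j = k` play no role.
  have hex : ∀ j v : Fin (n + 2), ∃ a : Fin (n + 1), j ≠ k →
      j.succAbove a = if v = j then k else v := by
    intro j v
    by_cases hj : j = k
    · exact ⟨0, fun h => absurd hj h⟩
    · obtain ⟨a, ha⟩ := Fin.exists_succAbove_eq (x := if v = j then k else v) (y := j) (by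
        split_ifs with h
        · exact Ne.symm hj
        · exact h)
      exact ⟨a, fun _ => ha⟩
  choose π hπ using hex
  have hface : ∀ {m : ℕ} (j : Fin (m + 2)) (F : SSet.stdSimplex.obj (SimplexCategory.mk (m + 1)) ⟶ (BG E G 𝒰).toSSet),
      (BG E G 𝒰).map (affineHom j.succAbove).op (SSet.yonedaEquiv F) =
        SSet.yonedaEquiv (SSet.stdSimplex.δ j ≫ F) := fun j F =>
    SSet.yonedaEquiv_naturality (SimplexCategory.δ j) F
  let b₀ : ∀ j ≠ k, (BG E G 𝒰).obj (op ⟨n⟩) := fun j hj => SSet.yonedaEquiv (f j hj)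
  let r : {j : Fin (n + 2) // j ≠ k} → ((⟨n + 1⟩ : SmSimplex) ⟶ ⟨n + 1⟩) :=
    fun j => affineHom fun v => if v = j.1 then k else v
  have hidem : ∀ i, r i ≫ r i = r i := fun i => by
    simp only [r, affineHom_comp]
    congr 1
    funext v
    split_ifs <;> rfl
  have hcomm : ∀ i j, r i ≫ r j = r j ≫ r i := fun i j => by
    have hi := i.2
    have hj := j.2
    simp only [r, affineHom_comp]
    congr 1
    funext v
    split_ifs <;> simp_all
  have hcompat : ∀ {d : SmSimplex} (x : d ⟶ ⟨n + 1⟩) (i j : {j : Fin (n + 2) // j ≠ k}),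
      x ≫ r i = x → x ≫ r j = x →
      (BG E G 𝒰).map (x ≫ affineHom (π i)).op (b₀ i i.2) =
        (BG E G 𝒰).map (x ≫ affineHom (π j)).op (b₀ j j.2) := by
    -- A horn in `Δ¹` has a single face, so there is no overlap to check.
    obtain _ | n := n
    · intro d x i j _ _
      have : i = j := by
        obtain ⟨i, hi⟩ := i
        obtain ⟨j, hj⟩ := j
        apply Subtype.ext
        simp only
        omega
      rw [this]
    · have key : ∀ {d : SmSimplex} (x : d ⟶ ⟨n + 2⟩) (i j : {j : Fin (n + 3) // j ≠ k}),
          i.1 < j.1 → x ≫ r i = x → x ≫ r j = x →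
          (BG E G 𝒰).map (x ≫ affineHom (π i)).op (b₀ i i.2) =
            (BG E G 𝒰).map (x ≫ affineHom (π j)).op (b₀ j j.2) := by
        intro d x i j hij hxi hxj
        refine map_eq_map_of_compatible (fun l hl v => hπ l v hl) b₀ i.2 j.2 hij ?_ x hxi hxj
        exact (hface _ _).trans ((congrArg SSet.yonedaEquiv (hf i.1 j.1 i.2 j.2 hij)).trans
          (hface _ _).symm)
      intro d x i j hxi hxj
      rcases lt_trichotomy i.1 j.1 with h | h | h
      · exact key x i j h hxi hxj
      · rw [Subtype.ext h]
      · exact (key x j i h hxj hxi).symm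
  -- On a simplex in face `j` the value is pulled back from `b₀ j`, consistently by `hcompat`. Off
  -- the horn any simplex of `BG` serves.
  have hbex : ∀ (d : SmSimplex) (x : d ⟶ ⟨n + 1⟩), ∃ β : (BG E G 𝒰).obj (op d),
      ∀ j : {j : Fin (n + 2) // j ≠ k}, x ≫ r j = x →
        β = (BG E G 𝒰).map (x ≫ affineHom (π j)).op (b₀ j j.2) := by
    intro d x
    by_cases h : ∃ i, x ≫ r i = x
    · obtain ⟨i, hi⟩ := h
      exact ⟨_, fun j hj => hcompat x i j hi hj⟩
    · obtain ⟨S⟩ := nonempty_EG (E := E) h𝒰 d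
      exact ⟨⟨S.1.bundle, S.2⟩, fun j hj => absurd ⟨j, hj⟩ h⟩
  choose b hb using hbex
  obtain ⟨P, hP⟩ := exists_BG_extension h𝒰 hidem hcomm b fun c d x f ⟨j, hx⟩ => by
    rw [hb d x j hx, hb c (f ≫ x) j (by rw [Category.assoc, hx])]
    rfl
  obtain ⟨Φ, hΦ⟩ := (SSet.yonedaEquiv (X := (BG E G 𝒰).toSSet)
    (n := SimplexCategory.mk (n + 1))).surjective P
  refine ⟨Φ, fun j hj => SSet.yonedaEquiv.injective ?_⟩
  refine (hface j Φ).symm.trans ?_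
  rw [hΦ]
  -- The inclusion of face `j` is itself a simplex of retract `j`, so the extension has the
  -- prescribed value on it, and `π j` undoes the inclusion.
  have hδr : affineHom j.succAbove ≫ r ⟨j, hj⟩ = affineHom j.succAbove := by
    simp only [r, affineHom_comp]
    congr 1
    funext v
    rw [if_neg (Fin.succAbove_ne j v)]
  have hδπ : affineHom j.succAbove ≫ affineHom (π j) = 𝟙 (⟨n⟩ : SmSimplex) := by
    rw [affineHom_comp, ← affineHom_id]
    congr 1
    funext v
    apply Fin.succAbove_right_injective (p := j)
    rw [hπ j _ hj, if_neg (Fin.succAbove_ne j v)]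
  refine (hP _ _ ⟨⟨j, hj⟩, hδr⟩).trans ((hb _ _ ⟨j, hj⟩ hδr).trans ?_)
  rw [hδπ]
  rfl
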